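/- **Conventions.** Let $R$ be a commutative artinian ring and let $\Lambda$ be an artin $R$-algebra, i.e. an $R$-algebra that is finitely generated as an $R$-module. All modules are finitely generated right $\Lambda$-modules. For a module $M$, $\mathrm{rad}(M)$ is the intersection of its maximal submodules, $\mathrm{rad}^0(M)=M$, $\mathrm{rad}^{i+1}(M)=\mathrm{rad}(\mathrm{rad}^i(M))$, $\mathrm{top}(M)=M/\mathrm{rad}(M)$, $\mathrm{soc}(M)$ is the sum of the simple submodules of $M$, and $l(M)$ is the length of $M$. A module is *local* if it has exactly one maximal submodule, *indecomposable* if it is nonzero and is not the direct sum of two nonzero submodules, and *uniserial* ($=1$-*factor serial*) if its submodules are totally ordered by inclusion (the zero module is uniserial). For $n>1$, a module $M$ of length $l\ge n$ is *$n$-factor serial* if $M/\mathrm{rad}^{l-n}(M)$ is uniserial and $M/\mathrm{rad}^{l-n+1}(M)$ is not uniserial. The algebra $\Lambda$ is *right $n$-Nakayama* if every indecomposable right $\Lambda$-module is $i$-factor serial for some $1\le i\le n$ and at least one indecomposable right $\Lambda$-module is $n$-factor serial. **Proposition.** Let $\Lambda$ be a right $4$-Nakayama artin algebra and let $M$ be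 an indecomposable $4$-factor serial right $\Lambda$-module. (a) If $M$ is local and $\mathrm{rad}(M)$ is indecomposable, then $\mathrm{soc}(M)$ is simple. (b) If $M$ is not local, then $l(\mathrm{top}(M))=2$. -/

import Mathlib

namespace FactorSerial

universe u

/-! The following notions are stated for modules over an arbitrary ring `A`.
Right modules over `Λ` are modules over `A = Λᵐᵒᵖ`. -/

/-- A module is uniserial if its submodules are totally ordered by inclusion
(so the zero module is uniserial). -/
def IsUniserial (A M : Type*) [Ring A] [AddCommGroup M] [Module A M] : Prop :=
  ∀ N K : Submodule A M, N ≤ K ∨ K ≤ N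

/-- A module is indecomposable if it is nonzero and is not the internal direct sum of two
nonzero submodules. -/
def IsIndecomposable (A M : Type*) [Ring A] [AddCommGroup M] [Module A M] : Prop :=
  Nontrivial M ∧ ∀ N K : Submodule A M, IsCompl N K → N = ⊥ ∨ K = ⊥

/-- A (finitely generated) module is local if it has exactly one maximal submodule. -/
def IsLocalModule (A M : Type*) [Ring A] [AddCommGroup M] [Module A M] : Prop :=
  ∃! N : Submodule A M, IsCoatom N

/-- The socle: the sum of all simple submodules. -/
def socle (A M : Type*) [Ring A] [AddCommGroup M] [Module A M] : Submodule A M :=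
  sSup {N : Submodule A M | IsSimpleModule A N}

/-- The iterated radical `rad^i M`, as a submodule of `M`: `rad^0 M = M` and
`rad^(i+1) M = rad (rad^i M)`, where `rad` is the intersection of all maximal submodules. -/
def radPow (A M : Type*) [Ring A] [AddCommGroup M] [Module A M] : ℕ → Submodule A M
  | 0 => ⊤
  | i + 1 => (Module.jacobson A (radPow A M i)).map (radPow A M i).subtype

/-- `n`-factor serial modules. A module is `1`-factor serial if it is uniserial. For `n > 1`, a
module of finite length `l ≥ n` is `n`-factor serial if `M / rad^(l-n) M` is uniserial and
`M / rad^(l-n+1) M` is not. -/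
def IsFactorSerial (A M : Type*) [Ring A] [AddCommGroup M] [Module A M] (n : ℕ) : Prop :=
  (n = 1 ∧ IsUniserial A M) ∨
  (1 < n ∧ ∃ l : ℕ, Module.length A M = l ∧ n ≤ l ∧
    IsUniserial A (M ⧸ radPow A M (l - n)) ∧
    ¬ IsUniserial A (M ⧸ radPow A M (l - n + 1)))

/-- `Λ` is right `n`-Nakayama if every finitely generated indecomposable right `Λ`-module is
`i`-factor serial for some `1 ≤ i ≤ n`, and some finitely generated indecomposable right
`Λ`-module is `n`-factor serial. Every finitely generated right `Λ`-module is a quotient of some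
`Λ ^ m`, hence has an isomorphic copy in the universe of `Λ`. -/
def IsRightNakayama (Λ : Type u) [Ring Λ] (n : ℕ) : Prop :=
  (∀ (M : Type u) [AddCommGroup M] [Module Λᵐᵒᵖ M] [Module.Finite Λᵐᵒᵖ M],
    IsIndecomposable Λᵐᵒᵖ M → ∃ i : ℕ, 1 ≤ i ∧ i ≤ n ∧ IsFactorSerial Λᵐᵒᵖ M i) ∧
  (∃ (M : Type u) (_ : AddCommGroup M) (_ : Module Λᵐᵒᵖ M), Module.Finite Λᵐᵒᵖ M ∧
    IsIndecomposable Λᵐᵒᵖ M ∧ IsFactorSerial Λᵐᵒᵖ M n)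

end FactorSerial

/-! A nonuniserial `n`-factor serial module longer than `n` has a uniserial quotient by a positive
radical power, so it is local. Hence in a right `4`-Nakayama algebra every indecomposable nonlocal
module has length at most four (`NonHollowLengthLeFour`), and only this consequence is used
afterwards.

It is exploited through amalgams. Glue hollow modules of total length at least six along a simple
module. The amalgam is not hollow and has length at least five, so it decomposes. Exchanging hollow
summands then gives maps from all the modules into one of them, the identity on that one, with sum
zero on the glued simple (`exists_extension`).

(a) If uniseriality fails below the first radical layer, an amalgam of two subquotients gives a
contradiction (`not_isHollow_chain`). So `M` has length five and its radical `Y` has length four and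
is not hollow. If the socle contained two simples `S₁` and `S₂`, some maximal submodule `V` of `Y`
would be hollow, and gluing `M` to `V / S₂` along `S₁` would either split `Y` or force `S₁ ≤ S₂`
(`isSimpleModule_socle`).

(b) Here `M` has length four and its top has length two or three. If it is three, the radical `J` is
simple and lies in every nonzero submodule, and the preimages of the three top factors have length
two. Gluing them along `J` shows that they are isomorphic to one module `U`. Let `E = End J` and let
`F` be the division ring of endomorphisms that extend to `U`. Independence of the three copies of
`U` in `M` gives `E` right `F`-dimension at least three. Lengths over `R` turn this into left
`F`-independent elements `1, β, γ`. Gluing three copies of `U` along `J` by these elements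
contradicts their independence (`false_of_three_factors`). -/

namespace FactorSerial

universe u v w

/-! ### Length as a natural number -/

section Length

variable {A M N : Type*} [Ring A] [AddCommGroup M] [Module A M] [AddCommGroup N] [Module A N]

/-- The length of a module as a natural number (zero if the length is infinite). -/
noncomputable def len (A M : Type*) [Ring A] [AddCommGroup M] [Module A M] : ℕ :=
  (Module.length A M).toNat

theorem coe_len [IsArtinian A M] [IsNoetherian A M] : (len A M : ℕ∞) = Module.length A M :=
  ENat.natCast_toNat Module.length_ne_top

theorem len_congr (e : M ≃ₗ[A] N) : len A M = len A N := by
  rw [len, len, e.length_eq]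

theorem len_le_of_injective [IsArtinian A N] [IsNoetherian A N] {f : M →ₗ[A] N}
    (hf : Function.Injective f) : len A M ≤ len A N :=
  ENat.toNat_le_toNat (Module.length_le_of_injective f hf) Module.length_ne_top

theorem len_le_of_surjective [IsArtinian A M] [IsNoetherian A M] {f : M →ₗ[A] N}
    (hf : Function.Surjective f) : len A N ≤ len A M :=
  ENat.toNat_le_toNat (Module.length_le_of_surjective f hf) Module.length_ne_top

theorem len_quotient_add [IsArtinian A M] [IsNoetherian A M] (X : Submodule A M) :
    len A (M ⧸ X) + len A X = len A M := by
  have h := Module.length_eq_add_of_exact X.subtype X.mkQ X.injective_subtype X.mkQ_surjective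
    (LinearMap.exact_subtype_mkQ X)
  rw [← coe_len, ← coe_len, ← coe_len] at h
  norm_cast at h
  omega

theorem len_range_add_ker [IsArtinian A M] [IsNoetherian A M] (f : M →ₗ[A] N) :
    len A (LinearMap.range f) + len A (LinearMap.ker f) = len A M := by
  rw [← len_congr f.quotKerEquivRange, len_quotient_add]

theorem len_eq_zero [IsArtinian A M] [IsNoetherian A M] : len A M = 0 ↔ Subsingleton M := by
  rw [← Module.length_eq_zero_iff (R := A), ← coe_len]
  norm_cast

theorem len_eq_one [IsArtinian A M] [IsNoetherian A M] : len A M = 1 ↔ IsSimpleModule A M := by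
  rw [← Module.length_eq_one_iff, ← coe_len]
  norm_cast

theorem len_of_isSimple [IsSimpleModule A M] : len A M = 1 := by
  rw [len, Module.length_eq_one]; rfl

theorem len_bot : len A (⊥ : Submodule A M) = 0 := by
  rw [len, Module.length_bot]; rfl

theorem len_top : len A (⊤ : Submodule A M) = len A M :=
  len_congr Submodule.topEquiv

section FiniteLength

variable [IsArtinian A M] [IsNoetherian A M] {X Y : Submodule A M}

theorem len_submodule_eq_zero : len A X = 0 ↔ X = ⊥ := by
  rw [len_eq_zero, Submodule.subsingleton_iff_eq_bot]

theorem len_mono (h : X ≤ Y) : len A X ≤ len A Y :=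
  len_le_of_injective (Submodule.inclusion_injective h)

theorem len_lt (h : X < Y) : len A X < len A Y := by
  have e := len_congr (Submodule.submoduleOfEquivOfLe h.le)
  have h1 := len_quotient_add (X.submoduleOf Y)
  have h2 : len A (Y ⧸ X.submoduleOf Y) ≠ 0 := fun h0 ↦ by
    rw [len_eq_zero, Submodule.Quotient.subsingleton_iff, Submodule.submoduleOf_eq_top] at h0
    exact h.not_ge h0
  omega

theorem eq_of_len_le (h : X ≤ Y) (h' : len A Y ≤ len A X) : X = Y := by
  by_contra hne
  exact absurd (len_lt (lt_of_le_of_ne h hne)) (by omega)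

theorem len_sup_add_inf (X Y : Submodule A M) :
    len A (X ⊔ Y : Submodule A M) + len A (X ⊓ Y : Submodule A M) = len A X + len A Y := by
  have h0 : X.comap X.subtype ⊓ Y.comap X.subtype = (X ⊓ Y).submoduleOf X := rfl
  have e := len_congr ((Submodule.quotEquivOfEq _ _ h0).symm.trans
    (LinearMap.quotientInfEquivSupQuotient X Y))
  change _ = len A (_ ⧸ Y.submoduleOf (X ⊔ Y)) at e
  have h1 := len_quotient_add ((X ⊓ Y).submoduleOf X)
  have h2 := len_quotient_add (Y.submoduleOf (X ⊔ Y))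
  have h3 := len_congr (Submodule.submoduleOfEquivOfLe (inf_le_left : X ⊓ Y ≤ X))
  have h4 := len_congr (Submodule.submoduleOfEquivOfLe (le_sup_right : Y ≤ X ⊔ Y))
  omega

theorem len_lt_len (h : X ≠ ⊤) : len A X < len A M := by
  rw [← len_top (A := A) (M := M)]; exact len_lt (lt_top_iff_ne_top.mpr h)

theorem len_of_covBy (h : X ⋖ Y) : len A Y = len A X + 1 := by
  have hs : IsSimpleModule A (Y ⧸ X.submoduleOf Y) :=
    (covBy_iff_quot_is_simple h.le).mp h
  have e := len_congr (Submodule.submoduleOfEquivOfLe h.le)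
  have h1 := len_quotient_add (X.submoduleOf Y)
  have h2 := len_of_isSimple (A := A) (M := Y ⧸ X.submoduleOf Y)
  omega

theorem covBy_of_len (h : X ≤ Y) (h' : len A Y = len A X + 1) : X ⋖ Y := by
  refine ⟨lt_of_le_of_ne h fun e ↦ by rw [e] at h'; omega, fun Z h1 h2 ↦ ?_⟩
  have := len_lt h1
  have := len_lt h2
  omega

end FiniteLength

end Length

/-! ### Hollow and local modules -/

section Hollow

variable {A M N : Type*} [Ring A] [AddCommGroup M] [Module A M] [AddCommGroup N] [Module A N]

/-- A module is hollow if it is not the sum of two proper submodules. For nonzero finitely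
generated modules this is the same as being local. -/
def IsHollow (A M : Type*) [Ring A] [AddCommGroup M] [Module A M] : Prop :=
  ∀ X Y : Submodule A M, X ⊔ Y = ⊤ → X = ⊤ ∨ Y = ⊤

theorem IsHollow.of_surjective (h : IsHollow A M) {f : M →ₗ[A] N} (hf : Function.Surjective f) :
    IsHollow A N := by
  intro X Y hXY
  have key : X.comap f ⊔ Y.comap f = ⊤ := by
    refine eq_top_iff.mpr fun x _ ↦ ?_
    obtain ⟨y, hy, z, hz, hyz⟩ := Submodule.mem_sup.mp (hXY ▸ Submodule.mem_top : f x ∈ X ⊔ Y)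
    obtain ⟨w, rfl⟩ := hf y
    refine Submodule.mem_sup.mpr ⟨w, hy, x - w, ?_, by abel⟩
    have : f (x - w) = z := by rw [map_sub, ← hyz]; abel
    simpa [Submodule.mem_comap, this] using hz
  refine (h _ _ key).imp (fun h ↦ ?_) (fun h ↦ ?_) <;>
  · refine eq_top_iff.mpr fun y _ ↦ ?_
    obtain ⟨x, rfl⟩ := hf y
    exact (h ▸ Submodule.mem_top : x ∈ Submodule.comap f _)

theorem IsUniserial.isHollow (h : IsUniserial A M) : IsHollow A M := by
  intro X Y hXY
  rcases h X Y with h | h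
  · exact .inr (by rwa [sup_eq_right.mpr h] at hXY)
  · exact .inl (by rwa [sup_eq_left.mpr h] at hXY)

theorem isHollow_coe_iff {V : Submodule A M} :
    IsHollow A V ↔ ∀ X Y : Submodule A M, X ⊔ Y = V → X = V ∨ Y = V := by
  constructor
  · intro h X Y hXY
    have hX : X ≤ V := hXY ▸ le_sup_left
    have hY : Y ≤ V := hXY ▸ le_sup_right
    have := h (X.submoduleOf V) (Y.submoduleOf V) (by
      rw [← Submodule.submoduleOf_sup_of_le hX hY, hXY, Submodule.submoduleOf_self])
    simp only [Submodule.submoduleOf_eq_top] at this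
    exact this.imp hX.antisymm hY.antisymm
  · intro h X Y hXY
    have := h (X.map V.subtype) (Y.map V.subtype) (by
      rw [← Submodule.map_sup, hXY, Submodule.map_subtype_top])
    refine this.imp (fun h ↦ ?_) (fun h ↦ ?_) <;>
    · refine Submodule.map_injective_of_injective V.injective_subtype ?_
      rw [h, Submodule.map_subtype_top]

theorem isIndecomposable_coe {V : Submodule A M} (h : IsIndecomposable A V) {X Y : Submodule A M}
    (hsup : X ⊔ Y = V) (hinf : X ⊓ Y = ⊥) : X = ⊥ ∨ Y = ⊥ := by
  have hX : X ≤ V := hsup ▸ le_sup_left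
  have hY : Y ≤ V := hsup ▸ le_sup_right
  have := h.2 (X.submoduleOf V) (Y.submoduleOf V) ⟨by
    rw [disjoint_iff, eq_bot_iff]
    intro x hx
    have : (x : M) ∈ X ⊓ Y := hx
    rw [hinf] at this
    simpa using this, by
    rw [codisjoint_iff, ← Submodule.submoduleOf_sup_of_le hX hY, hsup, Submodule.submoduleOf_self]⟩
  refine this.imp (fun h ↦ ?_) (fun h ↦ ?_)
  · rw [← inf_eq_right.mpr hX, ← Submodule.map_comap_subtype]
    exact (congrArg _ h).trans (Submodule.map_bot _)
  · rw [← inf_eq_right.mpr hY, ← Submodule.map_comap_subtype]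
    exact (congrArg _ h).trans (Submodule.map_bot _)

theorem IsHollow.le_of_isCoatom (h : IsHollow A M) {X C : Submodule A M} (hC : IsCoatom C)
    (hX : X ≠ ⊤) : X ≤ C := by
  by_contra hle
  have : C ⊔ X = ⊤ := hC.2 _ (by simpa using hle)
  rcases h _ _ this with h | h
  · exact hC.1 h
  · exact hX h

theorem IsHollow.isLocalModule [Nontrivial M] [Module.Finite A M] (h : IsHollow A M) :
    IsLocalModule A M := by
  obtain ⟨C, hC, -⟩ := (eq_top_or_exists_le_coatom (⊥ : Submodule A M)).resolve_left bot_ne_top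
  exact ⟨C, hC, fun D hD ↦ (hD.le_iff_eq hC.1).mp (h.le_of_isCoatom hC hD.1) |>.symm⟩

theorem IsLocalModule.isHollow [Module.Finite A M] (h : IsLocalModule A M) : IsHollow A M := by
  intro X Y hXY
  obtain ⟨C, hC, huniq⟩ := h
  by_contra! hne
  obtain ⟨D, hD, hXD⟩ := (eq_top_or_exists_le_coatom X).resolve_left hne.1
  obtain ⟨E, hE, hYE⟩ := (eq_top_or_exists_le_coatom Y).resolve_left hne.2
  rw [huniq D hD] at hXD
  rw [huniq E hE] at hYE
  exact hC.1 (eq_top_iff.mpr (hXY ▸ sup_le hXD hYE))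

theorem IsHollow.isCoatom_jacobson [Nontrivial M] [Module.Finite A M] (h : IsHollow A M) :
    IsCoatom (Module.jacobson A M) := by
  obtain ⟨C, hC, huniq⟩ := h.isLocalModule
  have : {m : Submodule A M | IsCoatom m} = {C} :=
    Set.ext fun D ↦ ⟨fun hD ↦ huniq D hD, fun hD ↦ by rw [hD]; exact hC⟩
  rw [Module.jacobson, this, sInf_singleton]
  exact hC

end Hollow

/-! ### Exchange of hollow summands -/

section Exchange

variable {A N ι : Type*} [Ring A] [AddCommGroup N] [Module A N]

/-- Writing `e (φ u) = z + φ v` splits `u` as `v + (u - v)`, with `φ v` in the first sum and `φ (u -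
v)` in the second. So `U` is the sum of the two preimages, and hollowness makes one of them all of
`U`. -/
theorem IsHollow.sup_range_comp {U : Type*} [AddCommGroup U] [Module A U] (hU : IsHollow A U)
    (φ : U →ₗ[A] N) {Z : Submodule A N} (hZ : Z ⊔ LinearMap.range φ = ⊤) {e e' : N →ₗ[A] N}
    (he : ∀ x, e x + e' x = x) :
    Z ⊔ LinearMap.range (e ∘ₗ φ) = ⊤ ∨ Z ⊔ LinearMap.range (e' ∘ₗ φ) = ⊤ := by
  have key : ((Z ⊔ LinearMap.range (e ∘ₗ φ)).comap φ) ⊔ ((Z ⊔ LinearMap.range (e' ∘ₗ φ)).comap φ)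
      = ⊤ := by
    refine eq_top_iff.mpr fun u _ ↦ ?_
    obtain ⟨z, hz, y, ⟨v, rfl⟩, hzv⟩ :=
      Submodule.mem_sup.mp (hZ ▸ Submodule.mem_top : e (φ u) ∈ Z ⊔ LinearMap.range φ)
    refine Submodule.mem_sup.mpr ⟨v, ?_, u - v, ?_, by abel⟩
    · refine Submodule.mem_comap.mpr
        (Submodule.mem_sup.mpr ⟨-z, Z.neg_mem hz, e (φ u), ⟨u, rfl⟩, ?_⟩)
      rw [← hzv]; abel
    · refine Submodule.mem_comap.mpr (Submodule.mem_sup.mpr ⟨z, hz, e' (φ u), ⟨u, rfl⟩, ?_⟩)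
      have h := he (φ u)
      rw [← hzv, add_right_comm] at h
      rw [map_sub, eq_sub_iff_add_eq, h]
  refine (hU _ _ key).imp (fun h ↦ ?_) (fun h ↦ ?_) <;>
  · rw [eq_top_iff, ← hZ]
    refine sup_le le_sup_left ?_
    rintro _ ⟨u, rfl⟩
    exact (h ▸ Submodule.mem_top : u ∈ Submodule.comap φ _)

/-- In a sum of hollow modules each summand may be replaced by its image under one of two
complementary endomorphisms. -/
theorem exists_coloring [Fintype ι] {U : ι → Type*} [∀ i, AddCommGroup (U i)]
    [∀ i, Module A (U i)] (hU : ∀ i, IsHollow A (U i)) (φ : ∀ i, U i →ₗ[A] N)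
    (hφ : ⨆ i, LinearMap.range (φ i) = ⊤) (e : Bool → N →ₗ[A] N)
    (he : ∀ x, e true x + e false x = x) :
    ∃ b : ι → Bool, ⨆ i, LinearMap.range (e (b i) ∘ₗ φ i) = ⊤ := by
  classical
  have key : ∀ s : Finset ι, ∃ c : ι → N →ₗ[A] N, (∀ i ∈ s, ∃ b, c i = e b) ∧
      (∀ i ∉ s, c i = LinearMap.id) ∧ ⨆ i, LinearMap.range (c i ∘ₗ φ i) = ⊤ := by
    intro s
    induction s using Finset.induction_on with
    | empty => exact ⟨fun _ ↦ LinearMap.id, by simp, by simp, hφ⟩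
    | insert k s hk ih =>
      obtain ⟨c, hc, hc', hsup⟩ := ih
      rw [iSup_split_single _ k, sup_comm, hc' k hk, LinearMap.id_comp] at hsup
      have hb : ∃ b, (⨆ (i) (_ : i ≠ k), LinearMap.range (c i ∘ₗ φ i)) ⊔
          LinearMap.range (e b ∘ₗ φ k) = ⊤ := by
        rcases (hU k).sup_range_comp (φ k) hsup he with h | h
        exacts [⟨_, h⟩, ⟨_, h⟩]
      obtain ⟨b, hb⟩ := hb
      refine ⟨Function.update c k (e b), fun i hi ↦ ?_, fun i hi ↦ ?_, ?_⟩
      · rcases eq_or_ne i k with rfl | hik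
        · exact ⟨b, by simp⟩
        · simpa [hik] using hc i ((Finset.mem_insert.mp hi).resolve_left hik)
      · rw [Finset.mem_insert, not_or] at hi
        simpa [hi.1] using hc' i hi.2
      · rw [iSup_split_single _ k, sup_comm, ← hb]
        congr 1
        · refine iSup_congr fun i ↦ iSup_congr fun hi ↦ ?_
          rw [Function.update_of_ne hi]
        · rw [Function.update_self]
  obtain ⟨c, hc, -, hsup⟩ := key Finset.univ
  choose b hb using fun i ↦ hc i (Finset.mem_univ i)
  exact ⟨b, by simpa [← hb] using hsup⟩

/-- A decomposition of `N` colours each `U i` by one of the two projections so that the projected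
maps still generate `N`. The new surjection `φ` respects the colours, and its simple kernel must
vanish in one colour. The factors of that colour split off `N`, which yields the retraction. -/
theorem exists_retraction_of_not_isIndecomposable [Fintype ι] [DecidableEq ι] {U : ι → Type*}
    [∀ i, AddCommGroup (U i)] [∀ i, Module A (U i)] [∀ i, IsArtinian A (U i)]
    [∀ i, IsNoetherian A (U i)] (hU : ∀ i, IsHollow A (U i)) (p : (∀ i, U i) →ₗ[A] N)
    (hp : Function.Surjective p) (hker : IsSimpleModule A (LinearMap.ker p))
    [Nontrivial N] (hN : ¬ IsIndecomposable A N) :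
    ∃ (k : ι) (f : ∀ i, U i →ₗ[A] U k), f k = LinearMap.id ∧
      ∀ x ∈ LinearMap.ker p, ∑ i, f i (x i) = 0 := by
  have : IsArtinian A N := isArtinian_of_surjective _ p hp
  have : IsNoetherian A N := isNoetherian_of_surjective p (LinearMap.range_eq_top.mpr hp)
  simp only [IsIndecomposable, not_and, not_forall, not_or] at hN
  obtain ⟨X, Y, hXY, hX, hY⟩ := hN inferInstance
  let e : Bool → N →ₗ[A] N := fun b ↦ bif b then X.projection Y hXY else Y.projection X hXY.symm
  have he : ∀ x, e true x + e false x = x :=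
    fun x ↦ Submodule.projection_add_projection_eq_self hXY x
  have hee : ∀ b b' x, e b (e b' x) = if b' = b then e b x else 0 := by
    rintro (_ | _) (_ | _) x
    · exact Submodule.projection_apply_of_mem_left _ (Submodule.projection_apply_mem _ _)
    · exact Submodule.projection_apply_of_mem_right _ (Submodule.projection_apply_mem _ _)
    · exact Submodule.projection_apply_of_mem_right _ (Submodule.projection_apply_mem _ _)
    · exact Submodule.projection_apply_of_mem_left _ (Submodule.projection_apply_mem _ _)
  have he0 : ∀ b, e b ≠ 0 := by
    rintro (_ | _) h
    · exact hY (by rw [← Submodule.range_projection hXY.symm]; exact LinearMap.range_eq_bot.mpr h)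
    · exact hX (by rw [← Submodule.range_projection hXY]; exact LinearMap.range_eq_bot.mpr h)
  have hsup : ⨆ i, LinearMap.range (p ∘ₗ LinearMap.single A U i) = ⊤ := by
    refine eq_top_iff.mpr fun y _ ↦ ?_
    obtain ⟨x, rfl⟩ := hp y
    rw [← LinearMap.sum_single_apply U x, map_sum]
    exact Submodule.sum_mem _ fun i _ ↦ Submodule.mem_iSup_of_mem i ⟨x i, rfl⟩
  obtain ⟨c, hc⟩ := exists_coloring hU _ hsup e he
  let φ : (∀ i, U i) →ₗ[A] N :=
    ∑ i, e (c i) ∘ₗ p ∘ₗ LinearMap.single A U i ∘ₗ LinearMap.proj i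
  have φ_apply : ∀ x, φ x = ∑ i, e (c i) (p (Pi.single i (x i))) := fun x ↦ by
    simp [φ, LinearMap.sum_apply]
  have φ_single : ∀ i u, φ (Pi.single i u) = e (c i) (p (Pi.single i u)) := fun i u ↦ by
    rw [φ_apply, Finset.sum_eq_single i, Pi.single_eq_same]
    · intro j _ hj
      rw [Pi.single_eq_of_ne hj, Pi.single_zero, map_zero, map_zero]
    · simp
  have hφ : Function.Surjective φ := by
    rw [← LinearMap.range_eq_top, eq_top_iff, ← hc]
    refine iSup_le fun i ↦ ?_
    rintro _ ⟨u, rfl⟩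
    exact ⟨Pi.single i u, φ_single i u⟩
  let ε : Bool → (∀ i, U i) →ₗ[A] (∀ i, U i) :=
    fun b ↦ LinearMap.pi fun i ↦ if c i = b then LinearMap.proj i else 0
  have ε_apply : ∀ b x i, ε b x i = if c i = b then x i else 0 := fun b x i ↦ by
    simp only [ε, LinearMap.pi_apply]; split_ifs <;> rfl
  have φ_ε : ∀ b x, φ (ε b x) = e b (φ x) := fun b x ↦ by
    rw [φ_apply, φ_apply, map_sum]
    refine Finset.sum_congr rfl fun i _ ↦ ?_
    rw [hee, ε_apply]
    split_ifs with h
    · rw [h]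
    · simp
  have ε_ε : ∀ b b' x, b' ≠ b → ε b (ε b' x) = 0 := fun b b' x hb ↦ by
    ext i
    rw [ε_apply, ε_apply]
    split_ifs with h h'
    · exact absurd (h'.symm.trans h) hb
    all_goals rfl
  -- Both surjections have the same source and target, so their kernels have equal length.
  have hkerφ : IsSimpleModule A (LinearMap.ker φ) := by
    have h1 := len_range_add_ker p
    have h2 := len_range_add_ker φ
    rw [LinearMap.range_eq_top.mpr hp] at h1
    rw [LinearMap.range_eq_top.mpr hφ] at h2
    have h3 := len_of_isSimple (A := A) (M := LinearMap.ker p)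
    rw [← len_eq_one]
    omega
  -- The kernel is stable under both `ε b`. If neither killed it, simplicity would make every
  -- element a multiple of a nonzero `ε true x`, which `ε false` kills.
  obtain ⟨b, hb⟩ : ∃ b, LinearMap.ker φ ≤ LinearMap.ker (ε b) := by
    by_contra! h
    obtain ⟨x, hx, hx'⟩ := SetLike.not_le_iff_exists.mp (h true)
    refine h false fun y hy ↦ ?_
    have hmem : ∀ b, ε b x ∈ LinearMap.ker φ := fun b ↦ by
      rw [LinearMap.mem_ker, φ_ε, hx, map_zero]
    obtain ⟨a, ha⟩ := IsSimpleModule.toSpanSingleton_surjective A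
      (m := (⟨ε true x, hmem true⟩ : LinearMap.ker φ)) (fun h ↦ hx' (congrArg Subtype.val h))
      ⟨y, hy⟩
    have ha' : a • ε true x = y := congrArg Subtype.val ha
    rw [LinearMap.mem_ker, ← ha', map_smul, ε_ε _ _ _ (by simp), smul_zero]
  -- Since `ε b` vanishes on `ker φ`, it factors through `φ`; `r` is the resulting map.
  let r : N →ₗ[A] (∀ i, U i) :=
    (LinearMap.ker φ).liftQ (ε b) hb ∘ₗ (φ.quotKerEquivOfSurjective hφ).symm.toLinearMap
  have r_φ : ∀ x, r (φ x) = ε b x := fun x ↦ by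
    have : (φ.quotKerEquivOfSurjective hφ).symm (φ x) = Submodule.Quotient.mk x := by
      rw [LinearEquiv.symm_apply_eq]; rfl
    simp only [r, LinearMap.comp_apply, LinearEquiv.coe_coe, this]
    rfl
  have r_e : ∀ y, r (e b y) = r y := fun y ↦ by
    have h0 : r (e (!b) y) = 0 := by
      obtain ⟨x, rfl⟩ := hφ y
      rw [← φ_ε, r_φ, ε_ε _ _ _ (by simp)]
    have h1 : e b y + e (!b) y = y := by
      cases b
      · rw [add_comm]; exact he y
      · exact he y
    conv_rhs => rw [← h1, map_add, h0, add_zero]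
  obtain ⟨k, hk⟩ : ∃ k, c k = b := by
    by_contra! h
    refine he0 b (LinearMap.ext fun y ↦ ?_)
    obtain ⟨x, rfl⟩ := hφ y
    have : ε b x = 0 := funext fun i ↦ by rw [ε_apply, if_neg (h i)]; rfl
    rw [← φ_ε, this, map_zero]; rfl
  refine ⟨k, fun i ↦ LinearMap.proj k ∘ₗ r ∘ₗ p ∘ₗ LinearMap.single A U i, ?_, fun x hx ↦ ?_⟩
  · ext u
    have := φ_single k u
    rw [hk] at this
    simp only [LinearMap.comp_apply, LinearMap.single_apply, LinearMap.proj_apply,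
      LinearMap.id_apply]
    rw [← r_e, ← this, r_φ, ε_apply, if_pos hk, Pi.single_eq_same]
  · have : ∑ i, (LinearMap.proj k ∘ₗ r ∘ₗ p ∘ₗ LinearMap.single A U i) (x i) =
        (LinearMap.proj k ∘ₗ r ∘ₗ p) (∑ i, LinearMap.single A U i (x i)) := by
      rw [map_sum]; rfl
    have hx' : ∑ i, LinearMap.single A U i (x i) = x := LinearMap.sum_single_apply U x
    rw [this, hx', LinearMap.comp_apply, LinearMap.comp_apply,
      LinearMap.mem_ker.mp hx, map_zero, map_zero]

end Exchange

/-! ### Amalgams along a simple module -/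

section Amalgam

/-- Finitely generated indecomposable modules which are not hollow have length at most four. -/
def NonHollowLengthLeFour (A : Type v) [Ring A] : Prop :=
  ∀ (N : Type w) [AddCommGroup N] [Module A N] [Module.Finite A N],
    IsIndecomposable A N → ¬ IsHollow A N → len A N ≤ 4

/-- Hollow modules amalgamated along a simple submodule: if the amalgam is too long, then it
decomposes, and one of the modules receives maps extending the gluing. -/
theorem exists_extension {A : Type v} [Ring A] (H : NonHollowLengthLeFour.{v, w} A)
    {ι : Type} [Fintype ι] [DecidableEq ι] {U : ι → Type w} {S : Type*} [AddCommGroup S]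
    [Module A S] [∀ i, AddCommGroup (U i)] [∀ i, Module A (U i)] [∀ i, IsArtinian A (U i)]
    [∀ i, IsNoetherian A (U i)] (hU : ∀ i, IsHollow A (U i)) (j : ∀ i, S →ₗ[A] U i)
    (hj : IsSimpleModule A (LinearMap.range (LinearMap.pi j)))
    {i₀ i₁ : ι} (hne : i₀ ≠ i₁) (hj₀ : LinearMap.range (j i₀) ≠ ⊤)
    (hj₁ : LinearMap.range (j i₁) ≠ ⊤) (hlen : 6 ≤ ∑ i, len A (U i)) :
    ∃ (k : ι) (f : ∀ i, U i →ₗ[A] U k), f k = LinearMap.id ∧ ∀ s, ∑ i, f i (j i s) = 0 := by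
  set K := LinearMap.range (LinearMap.pi j) with hK
  have hlenP : len A (∀ i, U i) = ∑ i, len A (U i) := by
    have : ((len A (∀ i, U i) : ℕ) : ℕ∞) = (∑ i, len A (U i) : ℕ) := by
      rw [coe_len, Module.length_pi_of_fintype, Nat.cast_sum]
      exact Finset.sum_congr rfl fun i _ ↦ coe_len.symm
    exact_mod_cast this
  have h1 := len_quotient_add K
  have h2 := len_of_isSimple (A := A) (M := K)
  have hnt : Nontrivial ((∀ i, U i) ⧸ K) := by
    by_contra h
    rw [not_nontrivial_iff_subsingleton, ← len_eq_zero (A := A)] at h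
    omega
  -- Requiring the `i`-th coordinate to lie in the image of `j i` gives a proper submodule of the
  -- amalgam. Two such submodules for distinct indices span it, so it is not hollow.
  have hprop : ∀ i, LinearMap.range (j i) ≠ ⊤ →
      ((LinearMap.range (j i)).comap (LinearMap.proj i)).map K.mkQ ≠ ⊤ := by
    intro i hi htop
    refine hi (eq_top_iff.mpr fun u _ ↦ ?_)
    obtain ⟨y, hy, hyx⟩ := (htop ▸ Submodule.mem_top : K.mkQ (Pi.single i u) ∈
      ((LinearMap.range (j i)).comap (LinearMap.proj i)).map K.mkQ)
    rw [← sub_eq_zero, ← map_sub, Submodule.mkQ_apply, Submodule.Quotient.mk_eq_zero] at hyx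
    obtain ⟨s, hs⟩ := hyx
    have hs' : j i s = y i - u := by simpa using congrFun hs i
    have : u = y i - j i s := by rw [hs']; abel
    rw [this]
    exact Submodule.sub_mem _ hy ⟨s, rfl⟩
  have hnh : ¬ IsHollow A ((∀ i, U i) ⧸ K) := by
    intro h
    refine (h _ _ ?_).elim (hprop i₀ hj₀) (hprop i₁ hj₁)
    rw [← Submodule.map_sup, eq_top_iff, ← Submodule.range_mkQ K, ← Submodule.map_top]
    refine Submodule.map_mono fun x _ ↦ Submodule.mem_sup.mpr
      ⟨Pi.single i₁ (x i₁), ?_, x - Pi.single i₁ (x i₁), ?_, by abel⟩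
    · simp [hne]
    · simp
  obtain ⟨k, f, hf, hf'⟩ := exists_retraction_of_not_isIndecomposable hU K.mkQ K.mkQ_surjective
    (by rw [Submodule.ker_mkQ]; exact hj) (fun h ↦ by have := H _ h hnh; omega)
  refine ⟨k, f, hf, fun s ↦ hf' (LinearMap.pi j s) ?_⟩
  rw [Submodule.ker_mkQ]
  exact ⟨s, rfl⟩

end Amalgam

section Pair

/-- The family of types over `Bool` with the two given members. -/
def PairFamily (X Y : Type w) : Bool → Type w
  | false => X
  | true => Y

instance (X Y : Type w) [AddCommGroup X] [AddCommGroup Y] : ∀ b, AddCommGroup (PairFamily X Y b)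
  | false => inferInstanceAs (AddCommGroup X)
  | true => inferInstanceAs (AddCommGroup Y)

instance (A : Type v) [Ring A] (X Y : Type w) [AddCommGroup X] [AddCommGroup Y]
    [Module A X] [Module A Y] : ∀ b, Module A (PairFamily X Y b)
  | false => inferInstanceAs (Module A X)
  | true => inferInstanceAs (Module A Y)

/-- The source `S` need not be simple: the glued module is its image in the product, the quotient by
the common kernel. This allows gluing along a subquotient. -/
theorem exists_extension_pair {A : Type v} [Ring A] (H : NonHollowLengthLeFour.{v, w} A)
    {X Y : Type w} {S : Type*} [AddCommGroup S] [Module A S] [AddCommGroup X] [Module A X]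
    [AddCommGroup Y] [Module A Y] [IsArtinian A X] [IsNoetherian A X] [IsArtinian A Y]
    [IsNoetherian A Y] (hX : IsHollow A X) (hY : IsHollow A Y) (j : S →ₗ[A] X) (j' : S →ₗ[A] Y)
    (hS : IsSimpleModule A (S ⧸ (LinearMap.ker j ⊓ LinearMap.ker j')))
    (hj : LinearMap.range j ≠ ⊤) (hj' : LinearMap.range j' ≠ ⊤) (hlen : 6 ≤ len A X + len A Y) :
    (∃ g : Y →ₗ[A] X, ∀ s, j s + g (j' s) = 0) ∨ (∃ f : X →ₗ[A] Y, ∀ s, f (j s) + j' s = 0) := by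
  have i1 : ∀ b, IsArtinian A (PairFamily X Y b) := by
    rintro (_ | _)
    · exact inferInstanceAs (IsArtinian A X)
    · exact inferInstanceAs (IsArtinian A Y)
  have i2 : ∀ b, IsNoetherian A (PairFamily X Y b) := by
    rintro (_ | _)
    · exact inferInstanceAs (IsNoetherian A X)
    · exact inferInstanceAs (IsNoetherian A Y)
  have hU : ∀ b, IsHollow A (PairFamily X Y b) := by
    rintro (_ | _)
    exacts [hX, hY]
  let J : ∀ b, S →ₗ[A] PairFamily X Y b := fun b ↦ match b with
    | false => j
    | true => j'
  have hker : LinearMap.ker (LinearMap.pi J) = LinearMap.ker j ⊓ LinearMap.ker j' := by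
    rw [LinearMap.ker_pi, iInf_bool_eq, inf_comm]; rfl
  have hrange : IsSimpleModule A (LinearMap.range (LinearMap.pi J)) :=
    (LinearEquiv.isSimpleModule_iff (((Submodule.quotEquivOfEq _ _ hker).symm.trans
      (LinearMap.pi J).quotKerEquivRange))).mp hS
  obtain ⟨k, f, hf, h⟩ := exists_extension H hU J hrange (i₀ := false) (i₁ := true) (by simp) hj hj'
    (by rw [Fintype.sum_bool, add_comm]; exact hlen)
  cases k
  · refine .inl ⟨f true, fun s ↦ ?_⟩
    have := h s
    rw [Fintype.sum_bool, add_comm, hf] at this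
    exact this
  · refine .inr ⟨f false, fun s ↦ ?_⟩
    have := h s
    rw [Fintype.sum_bool, add_comm, hf] at this
    exact this

end Pair

/-! ### Layers of the radical series -/

section Radical

variable {A M N : Type*} [Ring A] [AddCommGroup M] [Module A M] [AddCommGroup N] [Module A N]

theorem isUniserial_quotient_iff {X : Submodule A M} :
    IsUniserial A (M ⧸ X) ↔ ∀ N K : Submodule A M, X ≤ N → X ≤ K → N ≤ K ∨ K ≤ N := by
  constructor
  · intro h N K hN hK
    have e : ∀ {N : Submodule A M}, X ≤ N → (N.map X.mkQ).comap X.mkQ = N := fun hN ↦ by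
      rw [Submodule.comap_map_mkQ, sup_eq_right.mpr hN]
    refine (h (N.map X.mkQ) (K.map X.mkQ)).imp (fun h ↦ ?_) (fun h ↦ ?_) <;>
    · have := Submodule.comap_mono (f := X.mkQ) h
      rwa [e hN, e hK] at this
  · intro h N K
    refine (h (N.comap X.mkQ) (K.comap X.mkQ) (Submodule.le_comap_mkQ _ _)
      (Submodule.le_comap_mkQ _ _)).imp (fun h ↦ ?_) (fun h ↦ ?_) <;>
    · have := Submodule.map_mono (f := X.mkQ) h
      rwa [Submodule.map_comap_eq_of_surjective X.mkQ_surjective,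
        Submodule.map_comap_eq_of_surjective X.mkQ_surjective] at this

/-- The radical of a submodule, as a submodule of the ambient module. -/
def radOf (V : Submodule A M) : Submodule A M := (Module.jacobson A V).map V.subtype

theorem radOf_le (V : Submodule A M) : radOf V ≤ V := Submodule.map_subtype_le _ _

theorem radPow_succ (i : ℕ) : radPow A M (i + 1) = radOf (radPow A M i) := rfl

theorem radPow_one : radPow A M 1 = Module.jacobson A M :=
  Module.map_jacobson_of_bijective (f := (⊤ : Submodule A M).subtype)
    ⟨Submodule.injective_subtype _, fun x ↦ ⟨⟨x, Submodule.mem_top⟩, rfl⟩⟩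

theorem radPow_antitone : Antitone (radPow A M) := antitone_nat_of_succ_le fun _ ↦ radOf_le _

theorem radOf_bot : radOf (⊥ : Submodule A M) = ⊥ := eq_bot_iff.mpr (radOf_le _)

theorem isCoatom_submoduleOf_iff {C V : Submodule A M} (h : C ≤ V) :
    IsCoatom (C.submoduleOf V) ↔ C ⋖ V := by
  rw [← isSimpleModule_iff_isCoatom]
  exact (covBy_iff_quot_is_simple h).symm

theorem radOf_le_of_covBy {C V : Submodule A M} (h : C ⋖ V) : radOf V ≤ C :=
  Submodule.map_le_iff_le_comap.mpr (sInf_le ((isCoatom_submoduleOf_iff h.le).mpr h))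

theorem submoduleOf_map_subtype {V : Submodule A M} (D : Submodule A V) :
    (D.map V.subtype).submoduleOf V = D :=
  Submodule.comap_map_eq_of_injective V.injective_subtype D

theorem map_subtype_covBy {V : Submodule A M} {D : Submodule A V} (h : IsCoatom D) :
    D.map V.subtype ⋖ V := by
  rw [← isCoatom_submoduleOf_iff (Submodule.map_subtype_le _ _), submoduleOf_map_subtype]
  exact h

theorem IsHollow.le_of_covBy {V C X : Submodule A M} (h : IsHollow A V) (hC : C ⋖ V) (hX : X ≤ V)
    (hne : X ≠ V) : X ≤ C := by
  by_contra hle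
  have : X ⊔ C = V := by
    refine (hC.eq_or_eq (c := X ⊔ C) le_sup_right (sup_le hX hC.le)).resolve_left fun h ↦ hle ?_
    exact h ▸ le_sup_left
  exact (isHollow_coe_iff.mp h _ _ this).elim hne hC.ne

/-- The hypothesis makes `X ⊔ Y` contain `L`, so the modular law gives `(L ⊓ X) ⊔ Y = L`; as `L` is
hollow and `Y` proper, `L ⊓ X = L`. -/
theorem IsHollow.le_of_not_le {L Y X : Submodule A M} (hL : IsHollow A L) (hY : Y ⋖ L)
    (hcomp : ∀ X, Y ≤ X → X ≤ L ∨ L ≤ X) (hX : ¬ X ≤ Y) : L ≤ X := by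
  have hsup : L ≤ X ⊔ Y := by
    rcases hcomp (X ⊔ Y) le_sup_right with h | h
    · refine ((hY.eq_or_eq le_sup_right h).resolve_left fun h' ↦ hX ?_).ge
      exact h' ▸ le_sup_left
    · exact h
  have h : L ⊓ X ⊔ Y = L := by rw [inf_sup_assoc_of_le X hY.le, inf_eq_left.mpr hsup]
  have := (isHollow_coe_iff.mp hL _ _ h).resolve_right hY.ne
  exact inf_eq_left.mp this

variable [IsNoetherian A M]

theorem exists_le_covBy {X V : Submodule A M} (h : X < V) : ∃ C, C ⋖ V ∧ X ≤ C := by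
  obtain ⟨D, hD, hXD⟩ := (eq_top_or_exists_le_coatom (X.submoduleOf V)).resolve_left
    (fun h' ↦ h.not_ge (Submodule.submoduleOf_eq_top.mp h'))
  refine ⟨_, map_subtype_covBy hD, ?_⟩
  have := Submodule.map_mono (f := V.subtype) hXD
  rwa [Submodule.submoduleOf, Submodule.map_comap_subtype, inf_eq_right.mpr h.le] at this

theorem exists_covBy_of_not_isHollow {V : Submodule A M} (h : ¬ IsHollow A V) :
    ∃ V₁ V₂, V₁ ⋖ V ∧ V₂ ⋖ V ∧ V₁ ≠ V₂ := by
  rw [isHollow_coe_iff] at h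
  push Not at h
  obtain ⟨X, Y, hXY, hX, hY⟩ := h
  obtain ⟨C, hC, hXC⟩ := exists_le_covBy (lt_of_le_of_ne (hXY ▸ le_sup_left) hX)
  obtain ⟨D, hD, hYD⟩ := exists_le_covBy (lt_of_le_of_ne (hXY ▸ le_sup_right) hY)
  refine ⟨C, D, hC, hD, fun hCD ↦ ?_⟩
  have := sup_le hXC (hCD ▸ hYD)
  exact hC.lt.not_ge (hXY ▸ this)

theorem isHollow_of_radOf {V : Submodule A M}
    (h : ∀ X Y, radOf V ≤ X → radOf V ≤ Y → X ≤ Y ∨ Y ≤ X) : IsHollow A V := by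
  by_contra hV
  obtain ⟨V₁, V₂, h₁, h₂, hne⟩ := exists_covBy_of_not_isHollow hV
  rcases h _ _ (radOf_le_of_covBy h₁) (radOf_le_of_covBy h₂) with h | h
  · exact hne ((h₁.eq_or_eq h h₂.le).resolve_right h₂.ne).symm
  · exact hne ((h₂.eq_or_eq h h₁.le).resolve_right h₁.ne)

theorem IsHollow.radOf_covBy {V : Submodule A M} (h : IsHollow A V) (hV : V ≠ ⊥) :
    radOf V ⋖ V := by
  have : Nontrivial V := Submodule.nontrivial_iff_ne_bot.mpr hV
  exact map_subtype_covBy h.isCoatom_jacobson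

theorem isHollow_of_isUniserial_quotient {i : ℕ} (hi : i ≠ 0)
    (h : IsUniserial A (M ⧸ radPow A M i)) : IsHollow A M := by
  rw [isUniserial_quotient_iff] at h
  have hle : radPow A M i ≤ radPow A M 1 := radPow_antitone (Nat.one_le_iff_ne_zero.mpr hi)
  have : IsHollow A (⊤ : Submodule A M) :=
    isHollow_of_radOf fun X Y hX hY ↦ h X Y (hle.trans hX) (hle.trans hY)
  exact this.of_surjective (f := Submodule.subtype _) fun x ↦ ⟨⟨x, Submodule.mem_top⟩, rfl⟩

/-- If the length `l` differs from `n`, the exponent `l - n` is positive, and a uniserial quotient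
by a positive radical power forces hollowness. -/
theorem IsFactorSerial.len_eq {n : ℕ} (h : IsFactorSerial A M n) (hM : ¬ IsHollow A M) :
    len A M = n := by
  rcases h with ⟨-, h⟩ | ⟨-, l, hl, hnl, hu, -⟩
  · exact absurd h.isHollow hM
  · by_contra hne
    have : len A M = l := by rw [len, hl]; rfl
    exact hM (isHollow_of_isUniserial_quotient (by omega) hu)

/-- The shape of a module at the first layer where it stops being uniserial: the preceding term of
the radical series is hollow, the next one is not. -/
theorem radPow_structure {k : ℕ} (h : IsUniserial A (M ⧸ radPow A M (k + 1)))
    (h' : ¬ IsUniserial A (M ⧸ radPow A M (k + 2))) :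
    IsHollow A (radPow A M k) ∧ radPow A M (k + 1) ⋖ radPow A M k ∧
      ¬ IsHollow A (radPow A M (k + 1)) ∧
      ∀ X, radPow A M (k + 1) ≤ X → X ≤ radPow A M k ∨ radPow A M k ≤ X := by
  have hne : radPow A M (k + 1) ≠ ⊥ := fun h0 ↦ h' <| by
    rw [radPow_succ, h0, radOf_bot, ← h0]; exact h
  rw [isUniserial_quotient_iff] at h
  have hL : IsHollow A (radPow A M k) := isHollow_of_radOf h
  have hcov : radPow A M (k + 1) ⋖ radPow A M k :=
    hL.radOf_covBy fun h0 ↦ hne (by rw [radPow_succ, h0, radOf_bot])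
  have hcomp : ∀ X, radPow A M (k + 1) ≤ X → X ≤ radPow A M k ∨ radPow A M k ≤ X :=
    fun X hX ↦ h X _ hX hcov.le
  refine ⟨hL, hcov, fun hY ↦ h' ?_, hcomp⟩
  have hcov' : radPow A M (k + 2) ⋖ radPow A M (k + 1) := hY.radOf_covBy hne
  -- If `radPow A M (k + 1)` were hollow, its radical would add just one submodule at the bottom of
  -- the chain, and the larger quotient would be uniserial too.
  have key : ∀ X, radPow A M (k + 2) ≤ X → X = radPow A M (k + 2) ∨ radPow A M (k + 1) ≤ X := by
    intro X hX
    by_cases hXY : X ≤ radPow A M (k + 1)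
    · exact (hcov'.eq_or_eq hX hXY).imp id fun h ↦ h.ge
    · exact .inr (hcov.le.trans (hL.le_of_not_le hcov hcomp hXY))
  rw [isUniserial_quotient_iff]
  intro X Z hX hZ
  rcases key X hX with rfl | hX'
  · exact .inl hZ
  rcases key Z hZ with rfl | hZ'
  · exact .inr hX
  exact h X Z hX' hZ'

end Radical

/-! ### Uniseriality cannot fail deep in the radical series -/

section

variable {A M N : Type*} [Ring A] [AddCommGroup M] [Module A M] [AddCommGroup N] [Module A N]
theorem len_submoduleOf {X Y : Submodule A M} (h : X ≤ Y) : len A (X.submoduleOf Y) = len A X :=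
  len_congr (Submodule.submoduleOfEquivOfLe h)

theorem len_map_subtype {V : Submodule A M} (X : Submodule A V) :
    len A (X.map V.subtype) = len A X :=
  (len_congr (Submodule.equivMapOfInjective _ V.injective_subtype X)).symm

theorem IsHollow.map_ne_top [Nontrivial N] (hM : IsHollow A M) {L : Submodule A M} (hL : L ≠ ⊤)
    (f : M →ₗ[A] N) : L.map f ≠ ⊤ := by
  intro h
  have : L ⊔ LinearMap.ker f = ⊤ := by
    refine eq_top_iff.mpr fun x _ ↦ ?_
    obtain ⟨y, hy, hyx⟩ := (h ▸ Submodule.mem_top : f x ∈ L.map f)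
    exact Submodule.mem_sup.mpr ⟨y, hy, x - y, by simp [hyx], by abel⟩
  have h0 := LinearMap.ker_eq_top.mp ((hM _ _ this).resolve_left hL)
  rw [h0, Submodule.map_zero] at h
  exact bot_ne_top h

variable [IsArtinian A M] [IsNoetherian A M]

theorem len_map_add (f : M →ₗ[A] N) (Y : Submodule A M) :
    len A (Y.map f) + len A (Y ⊓ LinearMap.ker f : Submodule A M) = len A Y := by
  have h := len_range_add_ker (f.domRestrict Y)
  rw [LinearMap.range_domRestrict, LinearMap.ker_domRestrict, ← len_map_subtype] at h
  rw [← Submodule.map_comap_subtype]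
  exact h

theorem IsHollow.le_of_len_le {L Y W : Submodule A M} (hL : IsHollow A L) (hY : Y ⋖ L)
    (hW : W ≤ L) (hlen : len A L ≤ len A W + 1) : Y ≤ W := by
  by_contra hYW
  have hWL : W ≠ L := fun h ↦ hYW (h ▸ hY.le)
  have h1 := hL.le_of_covBy hY hW hWL
  have h2 := len_lt (lt_of_le_of_ne h1 fun h ↦ hYW h.ge)
  have h3 := len_lt hY.lt
  omega

theorem len_add_two_of_covBy {V₁ V₂ Y : Submodule A M} (h₁ : V₁ ⋖ Y) (h₂ : V₂ ⋖ Y) (hne : V₁ ≠ V₂) :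
    len A Y = len A (V₁ ⊓ V₂ : Submodule A M) + 2 := by
  have hsup : V₁ ⊔ V₂ = Y := by
    refine (h₁.eq_or_eq le_sup_left (sup_le h₁.le h₂.le)).resolve_left fun h ↦ hne ?_
    exact ((h₂.eq_or_eq (h ▸ le_sup_right) h₁.le).resolve_right h₁.ne)
  have h3 := len_sup_add_inf V₁ V₂
  rw [hsup] at h3
  have h4 := len_of_covBy h₁
  have h5 := len_of_covBy h₂
  omega

end

/-- For distinct maximal `V₁, V₂` in `Y` with intersection `C`, glue `M / C` (length at least four)
to `L / V₁` (length two) along `V₂ / C`. Either extension vanishes on `Y` after passing to a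
suitable quotient, which forces `V₂ ≤ V₁`. -/
theorem not_isHollow_chain {A : Type v} [Ring A] (H : NonHollowLengthLeFour.{v, w} A)
    {M : Type w} [AddCommGroup M] [Module A M] [IsArtinian A M] [IsNoetherian A M]
    (hM : IsHollow A M) {L Y : Submodule A M} (hL : IsHollow A L) (hLtop : L ≠ ⊤) (hY : Y ⋖ L)
    (hcomp : ∀ X, Y ≤ X → X ≤ L ∨ L ≤ X) : IsHollow A Y := by
  by_contra hnY
  obtain ⟨V₁, V₂, h₁, h₂, hne⟩ := exists_covBy_of_not_isHollow hnY
  have hnle : ¬ V₂ ≤ V₁ := fun h ↦ hne ((h₂.eq_or_eq h h₁.le).resolve_right h₁.ne)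
  set C := V₁ ⊓ V₂ with hC
  have lY := len_add_two_of_covBy h₁ h₂ hne
  rw [← hC] at lY
  have lY1 := len_of_covBy h₁
  have lY2 := len_of_covBy h₂
  have lL := len_of_covBy hY
  have lM := len_lt_len hLtop
  have lMC := len_quotient_add C
  have hV1L : V₁ ≤ L := h₁.le.trans hY.le
  have hV2L : V₂ ≤ L := h₂.le.trans hY.le
  have lB := len_quotient_add (V₁.submoduleOf L)
  rw [len_submoduleOf hV1L] at lB
  have hCV2 : C ⋖ V₂ := covBy_of_len inf_le_right (by omega)
  have hnt : Nontrivial (L ⧸ V₁.submoduleOf L) := by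
    by_contra h
    rw [not_nontrivial_iff_subsingleton, ← len_eq_zero (A := A)] at h
    omega
  let j : V₂ →ₗ[A] M ⧸ C := C.mkQ ∘ₗ V₂.subtype
  let j' : V₂ →ₗ[A] L ⧸ V₁.submoduleOf L :=
    (V₁.submoduleOf L).mkQ ∘ₗ Submodule.inclusion hV2L
  have kj : LinearMap.ker j = C.submoduleOf V₂ := by
    rw [LinearMap.ker_comp, Submodule.ker_mkQ]; rfl
  have kj' : LinearMap.ker j' = C.submoduleOf V₂ := by
    rw [LinearMap.ker_comp, Submodule.ker_mkQ]
    ext x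
    simp [hC, Submodule.submoduleOf]
  have rj := len_range_add_ker j
  have rj' := len_range_add_ker j'
  rw [kj, len_submoduleOf hCV2.le] at rj
  rw [kj', len_submoduleOf hCV2.le] at rj'
  rcases exists_extension_pair H (hM.of_surjective C.mkQ_surjective)
    (hL.of_surjective (V₁.submoduleOf L).mkQ_surjective) j j'
    (by rw [kj, kj', inf_idem]; exact (covBy_iff_quot_is_simple hCV2.le).mp hCV2)
    (fun h ↦ by rw [h, len_top] at rj; omega) (fun h ↦ by rw [h, len_top] at rj'; omega)
    (by omega) with ⟨g, hg⟩ | ⟨f, hf⟩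
  · set X := (LinearMap.range g).comap C.mkQ with hX
    -- Otherwise `X` contains `L`, but `L / C` has length three and the range of `g` at most two.
    have hXY : X ≤ Y := by
      by_contra hXY
      have h1 := len_mono (hL.le_of_not_le hY hcomp hXY)
      have h2 := len_map_add C.mkQ X
      rw [hX, Submodule.map_comap_eq_of_surjective C.mkQ_surjective, ← hX, Submodule.ker_mkQ,
        inf_eq_right.mpr (Submodule.le_comap_mkQ _ _)] at h2
      have h3 := len_range_add_ker g
      omega
    let h : L →ₗ[A] M ⧸ V₁ :=
      Submodule.factor (inf_le_left : C ≤ V₁) ∘ₗ g ∘ₗ (V₁.submoduleOf L).mkQ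
    have hr : LinearMap.range h ≤ Y.map V₁.mkQ := by
      rintro _ ⟨x, rfl⟩
      obtain ⟨y, hy⟩ := C.mkQ_surjective (g ((V₁.submoduleOf L).mkQ x))
      refine ⟨y, hXY ⟨_, hy.symm⟩, ?_⟩
      simp only [h, LinearMap.comp_apply, ← hy]
      rfl
    have l1 := len_mono hr
    have l2 := len_map_add V₁.mkQ Y
    rw [Submodule.ker_mkQ, inf_eq_right.mpr h₁.le] at l2
    have l3 := len_range_add_ker h
    have hle := hL.le_of_len_le hY (Submodule.map_subtype_le L (LinearMap.ker h))
      (by rw [len_map_subtype]; omega)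
    refine hnle fun x hx ↦ ?_
    obtain ⟨y, hy, rfl⟩ := hle (h₂.le hx)
    have h4 := congrArg (Submodule.factor (inf_le_left : C ≤ V₁)) (hg ⟨_, hx⟩)
    rw [map_add, map_zero] at h4
    have h5 : Submodule.factor (inf_le_left : C ≤ V₁) (g (j' ⟨L.subtype y, hx⟩)) = h y := rfl
    rw [h5, LinearMap.mem_ker.mp hy, add_zero] at h4
    exact (Submodule.Quotient.mk_eq_zero V₁).mp h4
  · let h : M →ₗ[A] L ⧸ V₁.submoduleOf L := f ∘ₗ C.mkQ
    -- The image of `L` is proper in a module of length two, so the kernel has colength at most one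
    -- in `L` and contains `Y`.
    have l1 := len_lt_len (hM.map_ne_top hLtop h)
    have l2 := len_map_add h L
    have hle := hL.le_of_len_le hY (inf_le_left : L ⊓ LinearMap.ker h ≤ L) (by omega)
    refine hnle fun x hx ↦ ?_
    have h3 := hf ⟨x, hx⟩
    have h4 : f (j ⟨x, hx⟩) = 0 := (hle (h₂.le hx)).2
    rw [h4, zero_add] at h3
    exact (Submodule.Quotient.mk_eq_zero (V₁.submoduleOf L)).mp h3

/-! ### The socle of a local module of length five -/

section

variable {A M : Type*} [Ring A] [AddCommGroup M] [Module A M]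

theorem le_of_covBy_of_isSimple {Y S C : Submodule A M} (hYi : IsIndecomposable A Y)
    (hS : IsSimpleModule A S) (hSY : S ≤ Y) (hC : C ⋖ Y) (hC0 : C ≠ ⊥) : S ≤ C := by
  have hS' := isSimpleModule_iff_isAtom.mp hS
  by_contra hSC
  have hsup : S ⊔ C = Y :=
    (hC.eq_or_eq le_sup_right (sup_le hSY hC.le)).resolve_left fun h ↦ hSC (h ▸ le_sup_left)
  have hinf : S ⊓ C = ⊥ := (hS'.le_iff.mp inf_le_left).resolve_right fun h ↦ hSC (inf_eq_left.mp h)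
  exact (isIndecomposable_coe hYi hsup hinf).elim hS'.1 hC0

variable [IsArtinian A M]

theorem exists_isSimple_pair [Nontrivial M] (h : ¬ IsSimpleModule A (socle A M)) :
    ∃ S₁ S₂ : Submodule A M, IsSimpleModule A S₁ ∧ IsSimpleModule A S₂ ∧ S₁ ≠ S₂ := by
  obtain ⟨S, hS, -⟩ := (eq_bot_or_exists_atom_le (⊤ : Submodule A M)).resolve_left top_ne_bot
  rw [← isSimpleModule_iff_isAtom] at hS
  by_contra! hno
  have : {N : Submodule A M | IsSimpleModule A N} = {S} :=
    Set.ext fun T ↦ ⟨fun hT ↦ hno T S hT hS, fun hT ↦ by rw [hT]; exact hS⟩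
  rw [socle, this, sSup_singleton] at h
  exact h hS

variable [IsNoetherian A M]

/-- If no maximal submodule `V` of `Y` were hollow, each would be `P ⊔ Z` with `P` of length at most
two. Since `Z` lies in every maximal submodule, two such `P` already generate `Y`, and by length the
sum is direct. -/
theorem exists_isHollow_covBy {Y Z : Submodule A M} (hYi : IsIndecomposable A Y)
    (hnY : ¬ IsHollow A Y) (hlen : len A Y = 4) (hZlen : len A Z = 2)
    (hZ : ∀ C, C ⋖ Y → Z ≤ C) : ∃ V, V ⋖ Y ∧ IsHollow A V := by
  obtain ⟨V₁, V₂, h₁, h₂, hne⟩ := exists_covBy_of_not_isHollow hnY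
  by_contra! hno
  have key : ∀ V, V ⋖ Y → ∃ P, P ⊔ Z = V ∧ len A P ≤ 2 := by
    intro V hV
    have hVlen := len_of_covBy hV
    have hZV : Z ⋖ V := covBy_of_len (hZ V hV) (by omega)
    have hnV := hno V hV
    rw [isHollow_coe_iff] at hnV
    push Not at hnV
    obtain ⟨P, Q, hPQ, hP, hQ⟩ := hnV
    have aux : ∀ P ≤ V, P ≠ V → ¬ P ≤ Z → ∃ P, P ⊔ Z = V ∧ len A P ≤ 2 := by
      intro P hPV hP hPZ
      refine ⟨P, ?_, ?_⟩
      · exact (hZV.eq_or_eq le_sup_right (sup_le hPV hZV.le)).resolve_left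
          fun h ↦ hPZ (h ▸ le_sup_left)
      · have := len_lt (lt_of_le_of_ne hPV hP)
        omega
    by_cases hPZ : P ≤ Z
    · refine aux Q (hPQ ▸ le_sup_right) hQ fun hQZ ↦ ?_
      exact hZV.lt.not_ge (hPQ ▸ sup_le hPZ hQZ)
    · exact aux P (hPQ ▸ le_sup_left) hP hPZ
  obtain ⟨P₁, hP₁, l₁⟩ := key V₁ h₁
  obtain ⟨P₂, hP₂, l₂⟩ := key V₂ h₂
  have hsup : P₁ ⊔ P₂ = Y := by
    by_contra hPY
    obtain ⟨C, hC, hPC⟩ := exists_le_covBy (lt_of_le_of_ne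
      (sup_le ((hP₁ ▸ le_sup_left).trans h₁.le) ((hP₂ ▸ le_sup_left).trans h₂.le)) hPY)
    have e₁ : V₁ = C := ((h₁.eq_or_eq (hP₁ ▸ sup_le (le_sup_left.trans hPC) (hZ C hC))
      hC.le).resolve_right hC.ne).symm
    have e₂ : V₂ = C := ((h₂.eq_or_eq (hP₂ ▸ sup_le (le_sup_right.trans hPC) (hZ C hC))
      hC.le).resolve_right hC.ne).symm
    exact hne (e₁.trans e₂.symm)
  have hl := len_sup_add_inf P₁ P₂
  rw [hsup] at hl
  have hinf : P₁ ⊓ P₂ = ⊥ := len_submodule_eq_zero.mp (by omega)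
  rcases isIndecomposable_coe hYi hsup hinf with h | h <;>
  · rw [h, len_bot] at hl
    omega

end

theorem isSimpleModule_socle {A : Type v} [Ring A] (H : NonHollowLengthLeFour.{v, w} A)
    {M : Type w} [AddCommGroup M] [Module A M] [IsArtinian A M] [IsNoetherian A M]
    (hM : IsHollow A M) {Y : Submodule A M} (hY : IsCoatom Y) (hYi : IsIndecomposable A Y)
    (hnY : ¬ IsHollow A Y) (hlen : len A Y = 4) : IsSimpleModule A (socle A M) := by
  have hYM : len A M = 5 := by
    rw [← len_top, len_of_covBy hY.covBy_top, hlen]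
  have : Nontrivial M := by
    by_contra h
    rw [not_nontrivial_iff_subsingleton, ← len_eq_zero (A := A)] at h
    omega
  have hleY : ∀ X : Submodule A M, len A X ≤ 4 → X ≤ Y := fun X hX ↦
    hM.le_of_isCoatom hY fun h ↦ by rw [h, len_top] at hX; omega
  by_contra hns
  obtain ⟨S₁, S₂, hS₁, hS₂, hne⟩ := exists_isSimple_pair hns
  have hS₁' := isSimpleModule_iff_isAtom.mp hS₁
  have hS₂' := isSimpleModule_iff_isAtom.mp hS₂
  have l₁ := len_of_isSimple (A := A) (M := S₁)
  have l₂ := len_of_isSimple (A := A) (M := S₂)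
  have hrad : ∀ S : Submodule A M, IsSimpleModule A S → ∀ C, C ⋖ Y → S ≤ C := fun S hS C hC ↦
    le_of_covBy_of_isSimple hYi hS (hleY S (by rw [len_of_isSimple]; omega)) hC fun h ↦ by
      have := len_of_covBy hC
      rw [h, len_bot] at this
      omega
  have hS12 : ¬ S₁ ≤ S₂ := fun h ↦ hne ((hS₂'.le_iff.mp h).resolve_left hS₁'.1)
  have lZ := len_sup_add_inf S₁ S₂
  rw [(hS₁'.le_iff.mp inf_le_left).resolve_right fun h ↦ hS12 (inf_eq_left.mp h), len_bot] at lZ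
  obtain ⟨V, hV, hVh⟩ := exists_isHollow_covBy (Z := S₁ ⊔ S₂) hYi hnY hlen (by omega)
    fun C hC ↦ sup_le (hrad _ hS₁ C hC) (hrad _ hS₂ C hC)
  have lV := len_of_covBy hV
  have h₁V := hrad _ hS₁ V hV
  have h₂V := hrad _ hS₂ V hV
  have lB := len_quotient_add (S₂.submoduleOf V)
  rw [len_submoduleOf h₂V] at lB
  have hnt : Nontrivial (V ⧸ S₂.submoduleOf V) := by
    by_contra h
    rw [not_nontrivial_iff_subsingleton, ← len_eq_zero (A := A)] at h
    omega
  let j' : S₁ →ₗ[A] V ⧸ S₂.submoduleOf V := (S₂.submoduleOf V).mkQ ∘ₗ Submodule.inclusion h₁V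
  have hker : (⊥ : Submodule A S₁) = LinearMap.ker S₁.subtype ⊓ LinearMap.ker j' := by
    rw [Submodule.ker_subtype, bot_inf_eq]
  have hrj' := len_range_add_ker j'
  rcases exists_extension_pair H hM (hVh.of_surjective (S₂.submoduleOf V).mkQ_surjective)
    S₁.subtype j' ((LinearEquiv.isSimpleModule_iff ((Submodule.quotEquivOfEqBot _ rfl).symm.trans
      (Submodule.quotEquivOfEq _ _ hker))).mp hS₁)
    (fun h ↦ by rw [Submodule.range_subtype] at h; rw [h, len_top] at l₁; omega)
    (fun h ↦ by rw [h, len_top] at hrj'; omega) (by omega) with ⟨g, hg⟩ | ⟨f, hf⟩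
  · let g₀ : V →ₗ[A] M := g ∘ₗ (S₂.submoduleOf V).mkQ
    set P := LinearMap.range g₀
    -- `V.subtype + g₀` kills `S₁`, so `P` and `Q` both have length at most two. Their sum contains
    -- the hollow `V` of length three and hence is `Y`, as a direct sum.
    set Q := LinearMap.range (V.subtype + g₀)
    have lP : len A P ≤ 2 := by
      have h1 := len_mono (LinearMap.range_comp_le_range (S₂.submoduleOf V).mkQ g)
      have h2 := len_range_add_ker g
      have h3 : len A P ≤ len A (LinearMap.range g) := h1
      omega
    have lQ : len A Q ≤ 2 := by
      have h1 : S₁.submoduleOf V ≤ LinearMap.ker (V.subtype + g₀) := fun x hx ↦ hg ⟨x, hx⟩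
      have h2 := len_mono h1
      rw [len_submoduleOf h₁V] at h2
      have h3 := len_range_add_ker (V.subtype + g₀)
      have h4 : len A Q = len A (LinearMap.range (V.subtype + g₀)) := rfl
      omega
    have hVPQ : V ≤ P ⊔ Q := fun x hx ↦ by
      refine Submodule.mem_sup.mpr ⟨-g₀ ⟨x, hx⟩, P.neg_mem ⟨_, rfl⟩,
        (V.subtype + g₀) ⟨x, hx⟩, ⟨_, rfl⟩, ?_⟩
      simp
    have hPQY : P ⊔ Q ≤ Y := sup_le (hleY P (by omega)) (hleY Q (by omega))
    have hsup : P ⊔ Q = Y := by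
      refine (hV.eq_or_eq hVPQ hPQY).resolve_left fun h ↦ ?_
      rcases isHollow_coe_iff.mp hVh _ _ h with h | h
      · rw [h] at lP; omega
      · rw [h] at lQ; omega
    have hl := len_sup_add_inf P Q
    rw [hsup] at hl
    have hinf : P ⊓ Q = ⊥ := len_submodule_eq_zero.mp (by omega)
    rcases isIndecomposable_coe hYi hsup hinf with h | h <;>
    · rw [h, len_bot] at hl
      omega
  · have h1 := len_lt_len (hM.map_ne_top hY.1 f)
    have h2 := len_map_add f Y
    -- The image of `Y` has length at most one, so the kernel on `Y` is `Y` or maximal in `Y`; both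
    -- contain `S₁`.
    have h3 : S₁ ≤ Y ⊓ LinearMap.ker f := by
      rcases eq_or_ne (Y ⊓ LinearMap.ker f) Y with h | h
      · rw [h]; exact h₁V.trans hV.le
      · have h4 := len_lt (lt_of_le_of_ne inf_le_left h)
        exact hrad _ hS₁ _ (covBy_of_len inf_le_left (by omega))
    refine hS12 fun x hx ↦ ?_
    have h4 := hf ⟨x, hx⟩
    have h5 : f (S₁.subtype ⟨x, hx⟩) = 0 := (h3 hx).2
    rw [h5, zero_add] at h4
    exact (Submodule.Quotient.mk_eq_zero (S₂.submoduleOf V)).mp h4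

/-! ### Preimages of the simple factors of the top -/

section

variable {A M : Type*} [Ring A] [AddCommGroup M] [Module A M] {ι : Type*} {Q : ι → Type*}
  [∀ i, AddCommGroup (Q i)] [∀ i, Module A (Q i)]

/-- The preimage of the `i`-th factor under a linear map to a product. -/
def factorPreimage (q : M →ₗ[A] ∀ i, Q i) (i : ι) : Submodule A M where
  carrier := {m | ∀ k, k ≠ i → q m k = 0}
  add_mem' ha hb k hk := by simp [ha k hk, hb k hk]
  zero_mem' := by simp
  smul_mem' a x hx k hk := by simp [hx k hk]

variable {q : M →ₗ[A] ∀ i, Q i} {J : Submodule A M} {i : ι}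

theorem mem_ker_of_apply_eq_zero {m : M} (hm : m ∈ factorPreimage q i) (h : q m i = 0) :
    m ∈ LinearMap.ker q := by
  refine LinearMap.mem_ker.mpr (funext fun k ↦ ?_)
  by_cases hk : k = i
  · rw [hk, h]; rfl
  · exact hm k hk

theorem le_factorPreimage (hq : LinearMap.ker q = J) : J ≤ factorPreimage q i := by
  rintro m hm k -
  rw [← hq, LinearMap.mem_ker] at hm
  rw [hm]; rfl

theorem mem_of_add_mem (hq : LinearMap.ker q = J) {k : ι} (hik : i ≠ k) {m n : M}
    (hm : m ∈ factorPreimage q i) (hn : n ∈ factorPreimage q k) (h : m + n ∈ J) : m ∈ J := by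
  rw [← hq] at h ⊢
  refine mem_ker_of_apply_eq_zero hm ?_
  have := congrFun (LinearMap.mem_ker.mp h) i
  simpa [hn i hik] using this

theorem mem_of_sum_mem [Fintype ι] (hq : LinearMap.ker q = J) {m : ι → M}
    (hm : ∀ i, m i ∈ factorPreimage q i) (h : ∑ i, m i ∈ J) (i : ι) : m i ∈ J := by
  rw [← hq] at h ⊢
  refine mem_ker_of_apply_eq_zero (hm i) ?_
  have := congrFun (LinearMap.mem_ker.mp h) i
  rw [map_sum, Finset.sum_apply, Finset.sum_eq_single i (fun k _ hk ↦ hm k i hk.symm)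
    (fun h ↦ absurd (Finset.mem_univ i) h)] at this
  exact this

variable [∀ i, IsSimpleModule A (Q i)]

theorem exists_sub_smul_mem (hq : LinearMap.ker q = J) {m n : M} (hm : m ∈ factorPreimage q i)
    (hn : n ∈ factorPreimage q i) (hn' : n ∉ J) : ∃ a : A, m - a • n ∈ J := by
  rw [← hq] at hn' ⊢
  obtain ⟨a, ha⟩ := IsSimpleModule.toSpanSingleton_surjective A
    (fun h ↦ hn' (mem_ker_of_apply_eq_zero hn h)) (q m i)
  refine ⟨a, mem_ker_of_apply_eq_zero (i := i)
    (Submodule.sub_mem _ hm (Submodule.smul_mem _ _ hn)) ?_⟩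
  have ha' : a • q n i = q m i := ha
  simp [ha']

/-- If `h` is nonzero, its range contains `J`, so some `v` outside `J` is sent into `J`. Every `u`
is a multiple of `v` modulo `J`, and `h` kills `J`. -/
theorem range_le_of_ker (hq : LinearMap.ker q = J) (hJ0 : J ≠ ⊥) (hJ : ∀ X ≠ ⊥, J ≤ X)
    (h : factorPreimage q i →ₗ[A] M) (h0 : ∀ u : factorPreimage q i, (u : M) ∈ J → h u = 0)
    (u : factorPreimage q i) :
    h u ∈ J := by
  by_contra hu
  have hle := hJ (LinearMap.range h) fun h ↦ hu (by
    rw [LinearMap.range_eq_bot.mp h]; exact J.zero_mem)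
  obtain ⟨x, hx, hx0⟩ := Submodule.exists_mem_ne_zero_of_ne_bot hJ0
  obtain ⟨v, rfl⟩ := hle hx
  obtain ⟨a, ha⟩ := exists_sub_smul_mem hq u.2 v.2 fun hv ↦ hx0 (h0 v hv)
  have := h0 (u - a • v) ha
  rw [map_sub, map_smul, sub_eq_zero] at this
  exact hu (this ▸ J.smul_mem a hx)

/-- An element of `X` outside `J` generates the preimage modulo `J`, and a nonzero `X` contains `J`.
-/
theorem le_of_ne_top (hq : LinearMap.ker q = J) (hJ : ∀ X ≠ ⊥, J ≤ X)
    {X : Submodule A (factorPreimage q i)} (hX : X ≠ ⊤) : ∀ x ∈ X, (x : M) ∈ J := by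
  intro x hx
  by_contra hxJ
  have hle := hJ (X.map (Submodule.subtype _)) fun h ↦ hxJ (by
    have : (x : M) ∈ X.map (Submodule.subtype _) := ⟨x, hx, rfl⟩
    rw [h, Submodule.mem_bot] at this
    rw [this]; exact J.zero_mem)
  refine hX (eq_top_iff.mpr fun y _ ↦ ?_)
  obtain ⟨a, ha⟩ := exists_sub_smul_mem hq y.2 x.2 hxJ
  obtain ⟨z, hz, hzy⟩ := hle ha
  have : y = z + a • x := Subtype.ext (by
    rw [Submodule.coe_add, Submodule.coe_smul]
    exact (eq_add_of_sub_eq hzy.symm))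
  rw [this]
  exact X.add_mem hz (X.smul_mem a hx)

theorem injective_of_apply_ne_zero {N : Type*} [AddCommGroup N] [Module A N]
    (hJ : ∀ X ≠ ⊥, J ≤ X) {V : Submodule A M} (f : V →ₗ[A] N) {s : V} (hs : (s : M) ∈ J)
    (hfs : f s ≠ 0) : Function.Injective f := by
  rw [← LinearMap.ker_eq_bot]
  by_contra h
  have hle := hJ ((LinearMap.ker f).map V.subtype) fun h' ↦ h (by
    exact Submodule.map_injective_of_injective V.injective_subtype
      (h'.trans (Submodule.map_bot _).symm))
  obtain ⟨t, ht, hts⟩ := hle hs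
  exact hfs (Subtype.ext hts ▸ ht)

variable [IsArtinian A M] [IsNoetherian A M]

theorem len_factorPreimage [DecidableEq ι] (hq : LinearMap.ker q = J)
    (hqs : Function.Surjective q) [IsSimpleModule A J] :
    len A (factorPreimage q i) = 2 := by
  let h : factorPreimage q i →ₗ[A] Q i := LinearMap.proj i ∘ₗ q ∘ₗ Submodule.subtype _
  have hr : LinearMap.range h = ⊤ := by
    refine LinearMap.range_eq_top.mpr fun y ↦ ?_
    obtain ⟨m, hm⟩ := hqs (Pi.single i y)
    refine ⟨⟨m, fun k hk ↦ ?_⟩, ?_⟩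
    · rw [hm, Pi.single_eq_of_ne hk]
    · simp [h, hm]
  have hk : LinearMap.ker h = J.submoduleOf (factorPreimage q i) := by
    ext u
    have : u ∈ J.submoduleOf (factorPreimage q i) ↔ (u : M) ∈ J := Iff.rfl
    rw [this]
    refine ⟨fun hu ↦ hq ▸ mem_ker_of_apply_eq_zero u.2 hu, fun hu ↦ ?_⟩
    rw [← hq, LinearMap.mem_ker] at hu
    exact congrFun hu i
  have hl := len_range_add_ker h
  rw [hr, len_top, hk, len_submoduleOf (le_factorPreimage hq), len_of_isSimple,
    len_of_isSimple] at hl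
  exact hl.symm

theorem exists_notMem [DecidableEq ι] (hq : LinearMap.ker q = J)
    (hqs : Function.Surjective q) [IsSimpleModule A J] :
    ∃ u ∈ factorPreimage q i, u ∉ J := by
  by_contra! h
  have h1 := len_mono (A := A) h
  have h2 := len_of_isSimple (A := A) (M := J)
  rw [len_factorPreimage hq hqs] at h1
  omega

theorem isHollow_factorPreimage [DecidableEq ι] (hq : LinearMap.ker q = J)
    (hqs : Function.Surjective q) [IsSimpleModule A J] (hJ : ∀ X ≠ ⊥, J ≤ X) :
    IsHollow A (factorPreimage q i) := by
  intro X Y hXY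
  by_contra! hne
  obtain ⟨u, hu, huJ⟩ := exists_notMem (i := i) hq hqs
  obtain ⟨x, hx, y, hy, hxy⟩ := Submodule.mem_sup.mp
    (hXY ▸ Submodule.mem_top : (⟨u, hu⟩ : factorPreimage q i) ∈ X ⊔ Y)
  refine huJ ?_
  have : u = x + y := (congrArg Subtype.val hxy).symm
  rw [this]
  exact J.add_mem (le_of_ne_top hq hJ hne.1 x hx) (le_of_ne_top hq hJ hne.2 y hy)

theorem apply_mem_of_isSimple [IsSimpleModule A J] (hJ : ∀ X ≠ ⊥, J ≤ X) {V : Submodule A M}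
    (hJV : J ≤ V) (f : V →ₗ[A] M) {s : V} (hs : (s : M) ∈ J) : f s ∈ J := by
  have hmem : f s ∈ (J.submoduleOf V).map f := ⟨s, hs, rfl⟩
  by_cases h : (J.submoduleOf V).map f = ⊥
  · rw [h, Submodule.mem_bot] at hmem
    rw [hmem]; exact J.zero_mem
  · have h1 := len_map_add f (J.submoduleOf V)
    rw [len_submoduleOf hJV] at h1
    rwa [← eq_of_len_le (hJ _ h) (by omega)] at hmem

theorem bijective_of_injective {X Y : Submodule A M} (h : len A Y ≤ len A X) {f : X →ₗ[A] Y}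
    (hf : Function.Injective f) : Function.Bijective f := by
  refine ⟨hf, LinearMap.range_eq_top.mp ?_⟩
  have h1 := len_range_add_ker f
  rw [LinearMap.ker_eq_bot.mpr hf, len_bot] at h1
  exact eq_of_len_le le_top (by rw [len_top]; omega)

end

/-! ### The three preimages are isomorphic -/

section

variable {A : Type v} [Ring A] {M : Type w} [AddCommGroup M] [Module A M] [IsArtinian A M]
  [IsNoetherian A M] {Q : Fin 3 → Type*} [∀ i, AddCommGroup (Q i)] [∀ i, Module A (Q i)]
  [∀ i, IsSimpleModule A (Q i)] {q : M →ₗ[A] ∀ i, Q i} {J : Submodule A M}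

theorem isSimpleModule_range {S N : Type*} [AddCommGroup S] [Module A S] [AddCommGroup N]
    [Module A N] [IsSimpleModule A S] {f : S →ₗ[A] N} (hf : Function.Injective f) :
    IsSimpleModule A (LinearMap.range f) :=
  (LinearEquiv.isSimpleModule_iff (LinearEquiv.ofInjective f hf)).mp inferInstance

/-- Glue the three preimages along `J`. A map that is nonzero on `J` is injective, hence bijective
because all lengths are two. -/
theorem nonempty_linearEquiv_factorPreimage (H : NonHollowLengthLeFour.{v, w} A)
    (hq : LinearMap.ker q = J) (hqs : Function.Surjective q) [IsSimpleModule A J]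
    (hJ : ∀ X ≠ ⊥, J ≤ X) (i : Fin 3) :
    Nonempty (factorPreimage q 0 ≃ₗ[A] factorPreimage q i) := by
  have hJ0 : J ≠ ⊥ := (isSimpleModule_iff_isAtom.mp ‹_›).1
  have hlen : ∀ i, len A (factorPreimage q i) = 2 := fun i ↦ len_factorPreimage hq hqs
  let j : ∀ i, J →ₗ[A] factorPreimage q i := fun i ↦ Submodule.inclusion (le_factorPreimage hq)
  have hjinj : Function.Injective (LinearMap.pi j) := fun x y hxy ↦
    Submodule.inclusion_injective (le_factorPreimage hq) (congrFun hxy 0)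
  have hjr : ∀ i, LinearMap.range (j i) ≠ ⊤ := fun i h ↦ by
    have h1 := len_range_add_ker (j i)
    rw [h, len_top, hlen, len_of_isSimple (M := J)] at h1
    omega
  obtain ⟨k, f, hf, hsum⟩ := exists_extension H (fun i ↦ isHollow_factorPreimage hq hqs hJ) j
    (isSimpleModule_range hjinj) (i₀ := 0) (i₁ := 1) (by decide) (hjr 0) (hjr 1)
    (by simp [hlen])
  by_cases hall : ∀ l, ∃ s, f l (j l s) ≠ 0
  · have hbij : ∀ l, Function.Bijective (f l) := fun l ↦ by
      obtain ⟨s, hs⟩ := hall l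
      exact bijective_of_injective (by rw [hlen, hlen]) (injective_of_apply_ne_zero hJ _ s.2 hs)
    exact ⟨(LinearEquiv.ofBijective _ (hbij 0)).trans (LinearEquiv.ofBijective _ (hbij i)).symm⟩
  · exfalso
    push Not at hall
    obtain ⟨l, hl⟩ := hall
    have hkl : k ≠ l := by
      rintro rfl
      obtain ⟨x, hx, hx0⟩ := Submodule.exists_mem_ne_zero_of_ne_bot hJ0
      have := hl ⟨x, hx⟩
      rw [hf] at this
      exact hx0 (congrArg Subtype.val this)
    have hthird : ∀ k l : Fin 3, k ≠ l → ∃ i, i ≠ k ∧ i ≠ l ∧ Finset.univ = {k, l, i} := by decide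
    obtain ⟨m, hmk, hml, huniv⟩ := hthird k l hkl
    -- As `f l` vanishes on `J`, so does inclusion plus `f m`. Hence its range lies in `J`,
    -- contradicting the independence of the `m`-th and `k`-th preimages modulo `J`.
    let h : factorPreimage q m →ₗ[A] M :=
      Submodule.subtype _ + Submodule.subtype _ ∘ₗ f m
    have h0 : ∀ u : factorPreimage q m, (u : M) ∈ J → h u = 0 := fun u hu ↦ by
      have h1 := hsum ⟨u, hu⟩
      rw [huniv, Finset.sum_insert (by simp [hkl, hmk.symm]),
        Finset.sum_insert (by simp [hml.symm]),
        Finset.sum_singleton, hl, zero_add, hf] at h1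
      exact congrArg Subtype.val h1
    obtain ⟨u, hu, huJ⟩ := exists_notMem (i := m) hq hqs
    exact huJ (mem_of_add_mem hq hmk hu (f m ⟨u, hu⟩).2
      (range_le_of_ker hq hJ0 hJ h h0 ⟨u, hu⟩))

end

/-! ### Extendable endomorphisms of the radical -/

section

variable {R : Type*} [CommRing R] {A : Type v} [Ring A] [Algebra R A] {M : Type w} [AddCommGroup M]
  [Module A M] [Module R M] [IsScalarTower R A M]

variable (R) in
/-- The endomorphisms of a submodule `J` which extend to a submodule `V` containing `J`. -/
def extendableEnd {J V : Submodule A M} (h : J ≤ V) : Submodule R (Module.End A J) where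
  carrier := {e | ∃ f : V →ₗ[A] V, ∀ s, f (Submodule.inclusion h s) = Submodule.inclusion h (e s)}
  add_mem' := by
    rintro a b ⟨f, hf⟩ ⟨g, hg⟩
    exact ⟨f + g, fun s ↦ by simp [hf, hg]⟩
  zero_mem' := ⟨0, fun s ↦ by simp⟩
  smul_mem' := by
    rintro c a ⟨f, hf⟩
    exact ⟨c • f, fun s ↦ by rw [LinearMap.smul_apply, hf]; rfl⟩

variable {J V : Submodule A M}

theorem one_mem_extendableEnd (h : J ≤ V) : 1 ∈ extendableEnd R h := ⟨LinearMap.id, fun _ ↦ rfl⟩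

theorem mul_mem_extendableEnd {h : J ≤ V} {a b : Module.End A J} (ha : a ∈ extendableEnd R h)
    (hb : b ∈ extendableEnd R h) : a * b ∈ extendableEnd R h := by
  obtain ⟨f, hf⟩ := ha
  obtain ⟨g, hg⟩ := hb
  exact ⟨f ∘ₗ g, fun s ↦ by rw [LinearMap.comp_apply, hg, hf]; rfl⟩

theorem bijective_of_extends [IsArtinian A M] [IsNoetherian A M] (h : J ≤ V)
    (hJ : ∀ X ≠ ⊥, J ≤ X) {e : Module.End A J} (he : e ≠ 0) {f : V →ₗ[A] V}
    (hf : ∀ s, f (Submodule.inclusion h s) = Submodule.inclusion h (e s)) :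
    Function.Bijective f := by
  obtain ⟨s, hs⟩ : ∃ s, e s ≠ 0 := by
    by_contra! h0
    exact he (LinearMap.ext h0)
  refine bijective_of_injective le_rfl (injective_of_apply_ne_zero hJ f
    (s := Submodule.inclusion h s) s.2 fun h0 ↦ hs ?_)
  rw [hf] at h0
  exact Submodule.inclusion_injective h (h0.trans (map_zero _).symm)

theorem exists_inverse_extendableEnd [IsArtinian A M] [IsNoetherian A M] [IsSimpleModule A J]
    {h : J ≤ V} (hJ : ∀ X ≠ ⊥, J ≤ X) {e : Module.End A J} (hmem : e ∈ extendableEnd R h)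
    (he : e ≠ 0) : ∃ e' ∈ extendableEnd R h, e' * e = 1 := by
  obtain ⟨f, hf⟩ := hmem
  have hfb := bijective_of_extends h hJ he hf
  have heb : Function.Bijective e := LinearMap.bijective_of_ne_zero he
  let f' := LinearEquiv.ofBijective f hfb
  let e' := LinearEquiv.ofBijective e heb
  have hs : ∀ s, e (e'.symm s) = s := e'.apply_symm_apply
  refine ⟨e'.symm.toLinearMap, ⟨f'.symm.toLinearMap, fun s ↦ ?_⟩, ?_⟩
  · refine hfb.1 ((f'.apply_symm_apply _).trans ?_)
    rw [hf]
    exact congrArg _ (hs s).symm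
  · ext s
    exact congrArg _ (e'.symm_apply_apply s)

theorem mem_extendableEnd_of_extends [IsArtinian A M] [IsNoetherian A M] [IsSimpleModule A J]
    (h : J ≤ V) (hJ : ∀ X ≠ ⊥, J ≤ X) (f : V →ₗ[A] V) :
    ∃ e ∈ extendableEnd R h, ∀ s, f (Submodule.inclusion h s) = Submodule.inclusion h (e s) := by
  let e : Module.End A J := (V.subtype ∘ₗ f ∘ₗ Submodule.inclusion h).codRestrict J fun s ↦
    apply_mem_of_isSimple hJ h (V.subtype ∘ₗ f) s.2
  have he : ∀ s, f (Submodule.inclusion h s) = Submodule.inclusion h (e s) :=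
    fun s ↦ Subtype.ext rfl
  exact ⟨e, ⟨f, he⟩, he⟩

theorem neg_add_neg_mul_eq {E : Type*} [Ring E] {x y β γ : E} (h : x + y * β + γ = 0) :
    -x + -y * β = γ := by
  rw [neg_mul, ← neg_add, neg_eq_iff_add_eq_zero, h]

/-- If `End J` has at least three times the length of the extendable endomorphisms, it contains
three elements which are left linearly independent over the extendable ones. -/
theorem exists_left_independent [IsArtinian A M] [IsNoetherian A M] [IsSimpleModule A J]
    {h : J ≤ V} (hJ : ∀ X ≠ ⊥, J ≤ X) [IsArtinian R (Module.End A J)]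
    [IsNoetherian R (Module.End A J)]
    (hlen : 3 * len R (extendableEnd R h) ≤ len R (Module.End A J)) :
    ∃ β γ : Module.End A J, ∀ a ∈ extendableEnd R h, ∀ b ∈ extendableEnd R h,
      ∀ c ∈ extendableEnd R h, a + b * β + c * γ = 0 → a = 0 ∧ b = 0 ∧ c = 0 := by
  set F := extendableEnd R h with hF
  have : Nontrivial J := IsSimpleModule.nontrivial A J
  have hF0 : len R F ≠ 0 := fun h0 ↦ by
    rw [len_submodule_eq_zero] at h0
    have h1 : (1 : Module.End A J) ∈ F := one_mem_extendableEnd h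
    rw [h0, Submodule.mem_bot] at h1
    exact one_ne_zero h1
  obtain ⟨β, hβ⟩ : ∃ β, β ∉ F := by
    by_contra! hall
    have : F = ⊤ := eq_top_iff.mpr fun x _ ↦ hall x
    rw [this, len_top] at hlen hF0
    omega
  let Φ : (F × F) →ₗ[R] Module.End A J :=
    F.subtype ∘ₗ LinearMap.fst R F F + LinearMap.mulRight R β ∘ₗ F.subtype ∘ₗ LinearMap.snd R F F
  have lFF : len R (F × F) = 2 * len R F := by
    have : ((len R (F × F) : ℕ) : ℕ∞) = (len R F + len R F : ℕ) := by
      rw [coe_len, Module.length_prod, Nat.cast_add, coe_len]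
    have : len R (F × F) = len R F + len R F := by exact_mod_cast this
    omega
  -- The range of `Φ` is `F + F β`, of length at most `2 * len R F`, hence not everything.
  obtain ⟨γ, hγ⟩ : ∃ γ, γ ∉ LinearMap.range Φ := by
    by_contra! hall
    have := len_le_of_surjective (A := R) (M := F × F) (N := Module.End A J) (f := Φ) hall
    omega
  refine ⟨β, γ, fun a ha b hb c hc h0 ↦ ?_⟩
  have hc0 : c = 0 := by
    by_contra hc0
    obtain ⟨c', hc', hcc⟩ := exists_inverse_extendableEnd hJ hc hc0
    refine hγ ⟨(⟨-(c' * a), F.neg_mem (mul_mem_extendableEnd hc' ha)⟩,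
      ⟨-(c' * b), F.neg_mem (mul_mem_extendableEnd hc' hb)⟩), ?_⟩
    have h1 : c' * (a + b * β + c * γ) = 0 := by rw [h0, mul_zero]
    rw [mul_add, mul_add, ← mul_assoc c' c, hcc, one_mul] at h1
    exact neg_add_neg_mul_eq (by rw [mul_assoc, h1])
  rw [hc0, zero_mul, add_zero] at h0
  have hb0 : b = 0 := by
    by_contra hb0
    obtain ⟨b', hb', hbb⟩ := exists_inverse_extendableEnd hJ hb hb0
    refine hβ ?_
    have h1 : b' * (a + b * β) = 0 := by rw [h0, mul_zero]
    rw [mul_add, ← mul_assoc, hbb, one_mul] at h1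
    rw [← neg_eq_of_add_eq_zero_right h1]
    exact F.neg_mem (mul_mem_extendableEnd hb' ha)
  rw [hb0, zero_mul, add_zero] at h0
  exact ⟨h0, hb0, hc0⟩

/-- Nonzero endomorphisms of a simple module are injective, so evaluation at a nonzero element
embeds `End J` into `M` over `R`. -/
theorem isNoetherian_isArtinian_end [IsNoetherian R M] [IsArtinian R M] [IsSimpleModule A J] :
    IsNoetherian R (Module.End A J) ∧ IsArtinian R (Module.End A J) := by
  have : Nontrivial J := IsSimpleModule.nontrivial A J
  obtain ⟨s, hs⟩ := exists_ne (0 : J)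
  let ev : Module.End A J →ₗ[R] M :=
    { toFun := fun e ↦ (e s : J)
      map_add' := fun _ _ ↦ rfl
      map_smul' := fun _ _ ↦ rfl }
  have hev : Function.Injective ev := by
    rw [← LinearMap.ker_eq_bot, LinearMap.ker_eq_bot']
    intro e he
    by_contra h0
    exact hs ((LinearMap.bijective_of_ne_zero h0).1
      ((Subtype.ext he : e s = 0).trans (map_zero e).symm))
  exact ⟨isNoetherian_of_injective ev hev, isArtinian_of_injective ev hev⟩

variable {Q : Fin 3 → Type*} [∀ i, AddCommGroup (Q i)] [∀ i, Module A (Q i)]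
  [∀ i, IsSimpleModule A (Q i)] {q : M →ₗ[A] ∀ i, Q i}

/-- The restrictions `α i` of the isomorphisms `φ i` to `J` are right independent over `F`. A
relation `∑ α i * e i = 0` gives a map killing `J`, hence with range in `J`, so each summand has
range in `J`. A nonzero `e i` would make the `i`-th summand map onto the `i`-th preimage. -/
theorem three_mul_len_extendableEnd_le [IsArtinian A M] [IsNoetherian A M] [IsSimpleModule A J]
    [IsArtinian R (Module.End A J)] [IsNoetherian R (Module.End A J)]
    (hq : LinearMap.ker q = J) (hqs : Function.Surjective q) (hJ : ∀ X ≠ ⊥, J ≤ X)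
    (φ : ∀ i, factorPreimage q 0 ≃ₗ[A] factorPreimage q i) :
    3 * len R (extendableEnd R (le_factorPreimage (i := 0) hq)) ≤ len R (Module.End A J) := by
  have hJ0 : J ≠ ⊥ := (isSimpleModule_iff_isAtom.mp ‹_›).1
  set F := extendableEnd R (le_factorPreimage (i := 0) hq) with hF
  let ι₀ : J →ₗ[A] factorPreimage q 0 := Submodule.inclusion (le_factorPreimage hq)
  let ψ : ∀ i, factorPreimage q 0 →ₗ[A] M := fun i ↦ Submodule.subtype _ ∘ₗ (φ i).toLinearMap
  let α : Fin 3 → Module.End A J := fun i ↦ (ψ i ∘ₗ ι₀).codRestrict J fun s ↦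
    apply_mem_of_isSimple hJ (le_factorPreimage hq) (ψ i) s.2
  let Θ : (Fin 3 → F) →ₗ[R] Module.End A J :=
    ∑ i, LinearMap.mulLeft R (α i) ∘ₗ F.subtype ∘ₗ LinearMap.proj i
  have Θ_apply : ∀ e s, Θ e s = ∑ i, α i ((e i : Module.End A J) s) := fun e s ↦ by
    simp [Θ, LinearMap.sum_apply]
  have hΘ : Function.Injective Θ := by
    intro e₁ e₂ hee
    set e : Fin 3 → F := e₁ - e₂ with he_def
    have e_apply : ∀ i s, (e i : Module.End A J) s =
        (e₁ i : Module.End A J) s - (e₂ i : Module.End A J) s := fun _ _ ↦ rfl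
    have he : ∀ s, ∑ i, α i ((e i : Module.End A J) s) = 0 := fun s ↦ by
      simp only [e_apply, map_sub, Finset.sum_sub_distrib]
      rw [← Θ_apply, ← Θ_apply, hee, sub_self]
    choose f hf using fun i ↦ (e i).2
    let h : factorPreimage q 0 →ₗ[A] M := ∑ i, ψ i ∘ₗ f i
    have h_apply : ∀ u, h u = ∑ i, ψ i (f i u) := fun u ↦ by simp [h, LinearMap.sum_apply]
    have h0 : ∀ u : factorPreimage q 0, (u : M) ∈ J → h u = 0 := fun u hu ↦ by
      have h1 := congrArg (fun s : J ↦ (s : M)) (he ⟨u, hu⟩)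
      simp only [Submodule.coe_sum] at h1
      rw [h_apply]
      refine Eq.trans (Finset.sum_congr rfl fun i _ ↦ ?_) h1
      have h2 : f i u = ι₀ ((e i : Module.End A J) ⟨u, hu⟩) := hf i ⟨u, hu⟩
      rw [h2]
      rfl
    refine sub_eq_zero.mp (he_def ▸ funext fun i ↦ ?_)
    by_contra hi
    have hfb := bijective_of_extends _ hJ (fun h ↦ hi (Subtype.ext h)) (hf i)
    obtain ⟨u, hu, huJ⟩ := exists_notMem (i := i) hq hqs
    obtain ⟨v, hv⟩ := hfb.2 ((φ i).symm ⟨u, hu⟩)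
    have h3 := range_le_of_ker hq hJ0 hJ h h0 v
    rw [h_apply] at h3
    have h4 := mem_of_sum_mem hq (m := fun i ↦ ψ i (f i v)) (fun i ↦ (φ i (f i v)).2) h3 i
    refine huJ ?_
    have h5 : ψ i (f i v) = u := by
      rw [hv]
      exact congrArg Subtype.val ((φ i).apply_symm_apply ⟨u, hu⟩)
    rwa [← h5]
  have h1 := len_le_of_injective (A := R) (M := Fin 3 → F) (N := Module.End A J) (f := Θ) hΘ
  have h2 : len R (Fin 3 → F) = 3 * len R F := by
    have : ((len R (Fin 3 → F) : ℕ) : ℕ∞) = (3 * len R F : ℕ) := by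
      rw [coe_len, Module.length_pi_of_fintype, Finset.sum_const, Finset.card_univ,
        Fintype.card_fin, ← coe_len, nsmul_eq_mul, Nat.cast_mul]
    exact_mod_cast this
  omega

theorem false_of_three_factors [IsNoetherian R M] [IsArtinian R M] [IsArtinian A M]
    [IsNoetherian A M] [IsSimpleModule A J] (H : NonHollowLengthLeFour.{v, w} A)
    (hq : LinearMap.ker q = J) (hqs : Function.Surjective q) (hJ : ∀ X ≠ ⊥, J ≤ X) : False := by
  obtain ⟨_, _⟩ := isNoetherian_isArtinian_end (R := R) (J := J)
  have : Nontrivial J := IsSimpleModule.nontrivial A J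
  have φ : ∀ i, factorPreimage q 0 ≃ₗ[A] factorPreimage q i :=
    fun i ↦ (nonempty_linearEquiv_factorPreimage H hq hqs hJ i).some
  have hJU : J ≤ factorPreimage q 0 := le_factorPreimage hq
  obtain ⟨β, γ, hind⟩ := exists_left_independent (R := R) (h := hJU) hJ
    (three_mul_len_extendableEnd_le hq hqs hJ φ)
  have hlen : len A (factorPreimage q 0) = 2 := len_factorPreimage hq hqs
  -- `J` is embedded in three copies of the same module with these twists. The splitting maps
  -- restrict to a left relation among them, whose `k`-th coefficient is the identity.
  let b : Fin 3 → Module.End A J := ![1, β, γ]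
  let j : Fin 3 → J →ₗ[A] factorPreimage q 0 := fun i ↦ Submodule.inclusion hJU ∘ₗ b i
  have hjinj : Function.Injective (LinearMap.pi j) := fun x y hxy ↦
    Submodule.inclusion_injective hJU (congrFun hxy 0)
  have hjr : ∀ i, LinearMap.range (j i) ≠ ⊤ := fun i h ↦ by
    have h1 := len_range_add_ker (j i)
    rw [h, len_top, hlen, len_of_isSimple (M := J)] at h1
    omega
  obtain ⟨k, f, hf, hsum⟩ := exists_extension H (U := fun _ ↦ factorPreimage q 0)
    (fun _ ↦ isHollow_factorPreimage hq hqs hJ) j (isSimpleModule_range hjinj) (i₀ := 0) (i₁ := 1)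
    (by decide) (hjr 0) (hjr 1) (by simp [hlen])
  choose e he hfe using fun i ↦ mem_extendableEnd_of_extends (R := R) hJU hJ (f i)
  have hzero : e 0 + e 1 * β + e 2 * γ = 0 := by
    ext s
    have h1 := hsum s
    simp only [j, LinearMap.comp_apply, hfe] at h1
    rw [Fin.sum_univ_three, ← map_add, ← map_add] at h1
    exact congrArg Subtype.val (Submodule.inclusion_injective hJU (h1.trans (map_zero _).symm))
  obtain ⟨h0, h1, h2⟩ := hind _ (he 0) _ (he 1) _ (he 2) hzero
  have hek : e k = 0 := by
    fin_cases k
    exacts [h0, h1, h2]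
  obtain ⟨s, hs⟩ := exists_ne (0 : J)
  have h3 := hfe k s
  rw [hek, hf] at h3
  exact hs (Submodule.inclusion_injective hJU h3)

end

/-! ### From the Nakayama condition to the two claims -/

section

variable {A : Type*} [Ring A] {M N : Type*} [AddCommGroup M] [Module A M] [AddCommGroup N]
  [Module A N]

theorem IsIndecomposable.of_equiv (e : M ≃ₗ[A] N) (h : IsIndecomposable A M) :
    IsIndecomposable A N := by
  obtain ⟨h1, h2⟩ := h
  refine ⟨e.symm.toEquiv.nontrivial, fun X Y hXY ↦ ?_⟩
  let o := Submodule.orderIsoMapComap e.symm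
  exact (h2 (o X) (o Y) (o.isCompl hXY)).imp (map_eq_bot_iff o).mp (map_eq_bot_iff o).mp

/-- `N` is replaced by an isomorphic quotient of a finite free module, which lives in the universe
over which the Nakayama condition quantifies. -/
theorem nonHollowLengthLeFour {Λ : Type u} [Ring Λ] [IsArtinianRing Λᵐᵒᵖ]
    (h : IsRightNakayama Λ 4) : NonHollowLengthLeFour.{u, w} Λᵐᵒᵖ := by
  intro N _ _ _ hN hnh
  obtain ⟨n, p, hp⟩ := Module.Finite.exists_fin' Λᵐᵒᵖ N
  let e := p.quotKerEquivOfSurjective hp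
  obtain ⟨i, -, hi, hfs⟩ := h.1 _ (hN.of_equiv e.symm)
  rw [← len_congr e, hfs.len_eq fun h' ↦ hnh (h'.of_surjective (f := e.toLinearMap) e.surjective)]
  exact hi

theorem isHollow_of_isSimple [IsSimpleModule A M] : IsHollow A M := by
  intro X Y hXY
  by_contra! hne
  rw [(eq_bot_or_eq_top X).resolve_right hne.1, (eq_bot_or_eq_top Y).resolve_right hne.2,
    sup_idem] at hXY
  exact bot_ne_top hXY

/-- In an indecomposable module which is not hollow every simple submodule lies in the radical. -/
theorem IsIndecomposable.le_jacobson (h : IsIndecomposable A M) (hM : ¬ IsHollow A M)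
    {S : Submodule A M} (hS : IsAtom S) : S ≤ Module.jacobson A M := by
  refine le_sInf fun C hC ↦ ?_
  by_contra hSC
  have hinf : S ⊓ C = ⊥ := (hS.le_iff.mp inf_le_left).resolve_right fun h ↦ hSC (inf_eq_left.mp h)
  have hsup : S ⊔ C = ⊤ := by
    rw [sup_comm]
    exact hC.2 _ (by simpa using hSC)
  rcases h.2 S C ⟨disjoint_iff.mpr hinf, codisjoint_iff.mpr hsup⟩ with h | h
  · exact hS.1 h
  · rw [h, sup_bot_eq] at hsup
    have : IsSimpleModule A (⊤ : Submodule A M) := isSimpleModule_iff_isAtom.mpr (hsup ▸ hS)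
    have : IsSimpleModule A M := (LinearEquiv.isSimpleModule_iff Submodule.topEquiv).mp this
    exact hM isHollow_of_isSimple

variable [IsNoetherian A M]

theorem isHollow_of_isCoatom_jacobson (h : IsCoatom (Module.jacobson A M)) : IsHollow A M := by
  intro X Y hXY
  by_contra! hne
  obtain ⟨C, hC, hXC⟩ := (eq_top_or_exists_le_coatom X).resolve_left hne.1
  obtain ⟨D, hD, hYD⟩ := (eq_top_or_exists_le_coatom Y).resolve_left hne.2
  have hc : ∀ C : Submodule A M, IsCoatom C → C = Module.jacobson A M := fun C hC ↦
    (h.le_iff_eq hC.1).mp (sInf_le hC)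
  rw [hc C hC] at hXC
  rw [hc D hD] at hYD
  exact h.1 (eq_top_iff.mpr (hXY ▸ sup_le hXC hYD))

end

theorem len_top_eq_two {R : Type*} [CommRing R] {A : Type v} [Ring A] [Algebra R A] {M : Type w}
    [AddCommGroup M] [Module A M] [Module R M] [IsScalarTower R A M] [IsArtinian R M]
    [IsNoetherian R M] [IsArtinian A M] [IsNoetherian A M] (H : NonHollowLengthLeFour.{v, w} A)
    (hM : IsIndecomposable A M) (hnh : ¬ IsHollow A M) (hlen : len A M = 4) :
    len A (M ⧸ Module.jacobson A M) = 2 := by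
  have hnt : Nontrivial M := hM.1
  set J := Module.jacobson A M with hJdef
  have hl := len_quotient_add J
  have h0 : len A (M ⧸ J) ≠ 0 := fun h ↦ by
    rw [len_eq_zero, Submodule.Quotient.subsingleton_iff] at h
    exact (Module.jacobson_lt_top A M).ne h
  have h1 : len A (M ⧸ J) ≠ 1 := fun h ↦ by
    rw [len_eq_one, isSimpleModule_iff_isCoatom] at h
    exact hnh (isHollow_of_isCoatom_jacobson h)
  have h4 : J ≠ ⊥ := fun h ↦ by
    obtain ⟨S, hS, -⟩ := (eq_bot_or_exists_atom_le (⊤ : Submodule A M)).resolve_left top_ne_bot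
    exact hS.1 (eq_bot_iff.mpr (h ▸ hM.le_jacobson hnh hS))
  rw [ne_eq, ← len_submodule_eq_zero] at h4
  have h3 : len A (M ⧸ J) ≠ 3 := fun h ↦ by
    have hJs : IsSimpleModule A J := len_eq_one.mp (by omega)
    have hJa := isSimpleModule_iff_isAtom.mp hJs
    -- Every simple submodule lies in the simple module `J`, hence equals it.
    have hJ : ∀ X : Submodule A M, X ≠ ⊥ → J ≤ X := fun X hX ↦ by
      obtain ⟨S, hS, hSX⟩ := (eq_bot_or_exists_atom_le X).resolve_left hX
      rwa [(hJa.le_iff.mp (hM.le_jacobson hnh hS)).resolve_left hS.1] at hSX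
    have : IsSemisimpleModule A (M ⧸ J) :=
      IsArtinian.isSemisimpleModule_iff_jacobson A _ |>.mpr (Module.jacobson_quotient_jacobson A M)
    obtain ⟨n, S, e, hS⟩ := IsSemisimpleModule.exists_linearEquiv_fin_dfinsupp A (M ⧸ J)
    let e' : (M ⧸ J) ≃ₗ[A] ∀ i, S i := e.trans DFinsupp.linearEquivFunOnFintype
    have hn : n = 3 := by
      have h5 : Module.length A (M ⧸ J) = n := by
        rw [e'.length_eq, Module.length_pi_of_fintype]
        simp
      rw [← coe_len, h] at h5
      exact_mod_cast h5.symm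
    subst hn
    exact false_of_three_factors (R := R) H (q := e'.toLinearMap ∘ₗ J.mkQ)
      (by rw [LinearMap.ker_comp, LinearEquiv.ker, ← LinearMap.ker, Submodule.ker_mkQ])
      (e'.surjective.comp J.mkQ_surjective) hJ
  omega

theorem isSimpleModule_socle_of_isFactorSerial {A : Type v} [Ring A] {M : Type w}
    [AddCommGroup M] [Module A M] [IsArtinian A M] [IsNoetherian A M]
    (H : NonHollowLengthLeFour.{v, w} A) [Nontrivial M] (hM : IsFactorSerial A M 4)
    (hh : IsHollow A M) (hrad : IsIndecomposable A (Module.jacobson A M)) :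
    IsSimpleModule A (socle A M) := by
  obtain ⟨h, -⟩ | ⟨-, l, hl, hl4, hu, hnu⟩ := hM
  · omega
  have hlen : len A M = l := by rw [len, hl]; rfl
  obtain ⟨k, rfl⟩ := Nat.exists_eq_add_of_le' hl4
  rw [Nat.add_sub_cancel] at hu hnu
  have hJ := hh.isCoatom_jacobson
  -- The length is `k + 4`. The case `k = 0` contradicts hollowness, `k = 1` makes the radical
  -- nonhollow of length four, and `k ≥ 2` is excluded by `not_isHollow_chain`.
  rcases k with _ | _ | k
  · rw [zero_add, radPow_one] at hnu
    refine absurd (isUniserial_quotient_iff.mpr fun X Y hX hY ↦ ?_) hnu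
    rcases eq_or_ne X ⊤ with h | h
    · exact .inr (h ▸ le_top)
    · exact .inl ((hh.le_of_isCoatom hJ h).trans hY)
  · obtain ⟨-, hcov, hnY, -⟩ := radPow_structure hu hnu
    have hY : radPow A M (0 + 1) = Module.jacobson A M := radPow_one
    rw [hY] at hcov hnY
    refine isSimpleModule_socle H hh hJ hrad hnY ?_
    have h1 := len_of_covBy hJ.covBy_top
    rw [len_top] at h1
    omega
  · obtain ⟨hL, hcov, hnY, hcomp⟩ := radPow_structure hu hnu
    refine absurd (not_isHollow_chain H hh hL (fun h ↦ hJ.1 ?_) hcov hcomp) hnY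
    have h1 : radPow A M (k + 1) ≤ radPow A M 1 := radPow_antitone (by omega)
    rwa [h, radPow_one, top_le_iff] at h1

end FactorSerial

theorem proposition3p2 {R : Type*} [CommRing R] [IsArtinianRing R]
    {Λ : Type*} [Ring Λ] [Algebra R Λ] [Module.Finite R Λ]
    (hΛ : FactorSerial.IsRightNakayama Λ 4)
    {M : Type*} [AddCommGroup M] [Module Λᵐᵒᵖ M] [Module.Finite Λᵐᵒᵖ M]
    (hM : FactorSerial.IsIndecomposable Λᵐᵒᵖ M)
    (hM4 : FactorSerial.IsFactorSerial Λᵐᵒᵖ M 4) :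
    (FactorSerial.IsLocalModule Λᵐᵒᵖ M →
      FactorSerial.IsIndecomposable Λᵐᵒᵖ (Module.jacobson Λᵐᵒᵖ M) →
      IsSimpleModule Λᵐᵒᵖ (FactorSerial.socle Λᵐᵒᵖ M)) ∧
    (¬ FactorSerial.IsLocalModule Λᵐᵒᵖ M →
      Module.length Λᵐᵒᵖ (M ⧸ Module.jacobson Λᵐᵒᵖ M) = 2) := by
  have : Module.Finite R Λᵐᵒᵖ := Module.Finite.equiv (MulOpposite.opLinearEquiv R)
  have : IsArtinianRing Λᵐᵒᵖ := IsArtinianRing.of_finite R Λᵐᵒᵖ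
  have : Nontrivial M := hM.1
  have H := FactorSerial.nonHollowLengthLeFour hΛ
  refine ⟨fun hl hrad ↦ FactorSerial.isSimpleModule_socle_of_isFactorSerial H hM4 hl.isHollow hrad,
    fun hl ↦ ?_⟩
  -- The central action of `R` supplies the finite lengths that compare left and right dimensions.
  let _ : Module R M := Module.compHom M (algebraMap R Λᵐᵒᵖ)
  have : IsScalarTower R Λᵐᵒᵖ M := ⟨fun r a m ↦ by
    rw [Algebra.smul_def, mul_smul]; rfl⟩
  have : Module.Finite R M := Module.Finite.trans Λᵐᵒᵖ M
  have hnh : ¬ FactorSerial.IsHollow Λᵐᵒᵖ M := fun h ↦ hl h.isLocalModule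
  rw [← FactorSerial.coe_len, FactorSerial.len_top_eq_two (R := R) H hM hnh (hM4.len_eq hnh)]
  rfl
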